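/- \textbf{Theorem (Combinatorial Reduction of Singularities).} For every polyhedra system $\mathcal D$ all of whose polyhedra are non-empty, there is a finite sequence of characteristic transforms $$\mathcal D=\mathcal D_0\rightarrow\mathcal D_1\rightarrow\cdots\rightarrow\mathcal D_k\qquad(k\ge 0)$$ such that $\mathrm{Sing}(\mathcal D_k)=\emptyset$. Here the following definitions are used. A \emph{support fabric} is a pair $\mathcal F=(I,\mathcal H)$ where $I$ is a finite set and $\mathcal H$ is a set of subsets of $I$ (the \emph{strata}) such that $J_1\subset J_2\in\mathcal H$ implies $J_1\in\mathcal H$. The \emph{blow-up} of $\mathcal F$ centered in a non-empty stratum $J$ is the support fabric $\pi_J(\mathcal F)=(I\cup\{\infty\},\mathcal H')$, $\infty\notin I$, where $$\mathcal H'=\{L\in\mathcal H:\ J\not\subset L\}\ \cup\ \{(K\setminus J)\cup A\cup\{\infty\}:\ K\in\mathcal H,\ J\subset K,\ A\subsetneq J\}.$$ For a finite set $J$ and $A\subset\mathbb R_{\ge 0}^J$, let $[[A]]$ be the convex hull of $A+\mathbb R^J_{\ge 0}$. A set $\Delta\subset\mathbb R^J_{\ge 0}$ is a \emph{characteristic polyhedron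 with denominator} $d\in\mathbb Z_{>0}$ if $\Delta=[[A]]$ for some $A\subset\frac1d\mathbb Z_{\ge 0}^J$. A \emph{polyhedra system} $\mathcal D=(\mathcal F;\{\Delta_J\}_{J\in\mathcal H},d)$ consists of a support fabric $\mathcal F=(I,\mathcal H)$, an integer $d\geq 1$ and, for each $J\in\mathcal H$, a characteristic polyhedron $\Delta_J\subset\mathbb R^J_{\ge 0}$ with denominator $d$, such that $\Delta_{J_1}$ is the image of $\Delta_{J_2}$ under the restriction map $\mathbb R^{J_2}\to\mathbb R^{J_1}$ whenever $J_1\subset J_2\in\mathcal H$. For non-empty $\Delta\subset\mathbb R_{\ge 0}^J$ as above, the \emph{contact exponent} is $\delta(\Delta)=\min\{\sum_{j\in J}\sigma(j):\ \sigma\in\Delta\}$ if $J\neq\emptyset$, and $\delta(\Delta)=-1$ if $J=\emptyset$. The \emph{singular locus} of $\mathcal D$ is $\mathrm{Sing}(\mathcal D)=\{J\in\mathcal H:\ \delta(\Delta_J)\ge 1\}$. For $J\in\mathrm{Sing}(\mathcal D)$, the \emph{characteristic transform} of $\mathcal D$ centered in $J$ is the polyhedra system $\Lambda_J(\mathcal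 D)=(\pi_J(\mathcal F);\{\Delta'_{J'}\}_{J'\in\mathcal H'},d)$ given as follows. If $\infty\notin J'$, then $\Delta'_{J'}=\Delta_{J'}$. If $\infty\in J'$, put $K=(J'\setminus\{\infty\})\cup J\in\mathcal H$ and let $\lambda_{J'}:\mathbb R^K\to\mathbb R^{J'}$ be defined by $\lambda_{J'}(\sigma)(j)=\sigma(j)$ for $j\neq\infty$ and $\lambda_{J'}(\sigma)(\infty)=\sum_{j\in J}\sigma(j)$; then $\Delta'_{J'}=[[\lambda_{J'}(\Delta_K)]]-e_{\infty}$, where $e_\infty\in\mathbb R^{J'}$ is the standard basis vector of the coordinate $\infty$. A \emph{sequence of characteristic transforms} is one in which each $\mathcal D_{i+1}$ is $\Lambda_{J}(\mathcal D_i)$ for some $J\in\mathrm{Sing}(\mathcal D_i)$. -/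

import Mathlib

open scoped Pointwise

universe u

namespace PolyhedraSystems

/-! ### Support fabrics -/

/-- A support fabric `(I, H)` with index set `I` (a finite type wherever it matters): a set `H` of
finite subsets of `I` (the strata) which is closed under passing to subsets, i.e. open for the
Zariski topology on the power set. -/
structure SupportFabric (I : Type u) where
  strata : Set (Finset I)
  mem_of_subset : ∀ ⦃J₁ J₂ : Finset I⦄, J₁ ⊆ J₂ → J₂ ∈ strata → J₁ ∈ strata

/-- The strata of the blow-up centered in `J`, as subsets of `I ∪ {∞} = Option I` (`none` is `∞`):
the strata of `H` that do not contain `J`, together with the sets `(K \ J) ∪ A ∪ {∞}` where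
`J ⊆ K ∈ H` and `A ⊊ J`. -/
def blowUpStrata {I : Type u} [DecidableEq I] (H : Set (Finset I)) (J : Finset I) :
    Set (Finset (Option I)) :=
  {J' | ∃ L ∈ H, ¬ J ⊆ L ∧ J' = L.map Function.Embedding.some} ∪
  {J' | ∃ K ∈ H, J ⊆ K ∧ ∃ A : Finset I, A ⊂ J ∧ J' = Finset.insertNone ((K \ J) ∪ A)}

theorem mem_blowUpStrata_of_none_mem {I : Type u} [DecidableEq I] {H : Set (Finset I)}
    {J : Finset I} {J' : Finset (Option I)} (h : none ∈ J') :
    J' ∈ blowUpStrata H J ↔ J'.eraseNone ∪ J ∈ H ∧ ¬ J ⊆ J'.eraseNone := by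
  constructor
  · rintro (⟨L, _, _, rfl⟩ | ⟨K, hK, hJK, A, hA, rfl⟩)
    · simp at h
    · rw [Finset.eraseNone_insertNone]
      have e : K \ J ∪ A ∪ J = K := by
        ext x; have := @hJK x; have := @hA.1 x
        simp only [Finset.mem_union, Finset.mem_sdiff]; tauto
      refine ⟨by rw [e]; exact hK, fun hs => hA.2 fun x hx => ?_⟩
      have := hs hx
      simp only [Finset.mem_union, Finset.mem_sdiff] at this; tauto
  · rintro ⟨h1, h2⟩
    refine Or.inr ⟨_, h1, Finset.subset_union_right, J'.eraseNone ∩ J,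
      ⟨Finset.inter_subset_right, fun hs => h2 fun x hx => (Finset.mem_inter.1 (hs hx)).1⟩, ?_⟩
    ext x
    cases x with
    | none => simpa using h
    | some x =>
      simp only [Finset.some_mem_insertNone, Finset.mem_union, Finset.mem_sdiff, Finset.mem_inter,
        Finset.mem_eraseNone]
      tauto

theorem mem_blowUpStrata_of_none_notMem {I : Type u} [DecidableEq I] {H : Set (Finset I)}
    {J : Finset I} {J' : Finset (Option I)} (h : none ∉ J') :
    J' ∈ blowUpStrata H J ↔ J'.eraseNone ∈ H ∧ ¬ J ⊆ J'.eraseNone := by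
  constructor
  · rintro (⟨L, hL, hJ, rfl⟩ | ⟨K, _, _, A, _, rfl⟩)
    · rw [Finset.eraseNone_map_some]; exact ⟨hL, hJ⟩
    · simp at h
  · rintro ⟨h1, h2⟩
    refine Or.inl ⟨_, h1, h2, ?_⟩
    ext x
    cases x with
    | none => simpa using h
    | some x => simp

/-- The blow-up `π_J(F)` of the support fabric `F` centered in `J`. -/
def SupportFabric.blowUp {I : Type u} [DecidableEq I] (F : SupportFabric I) (J : Finset I) :
    SupportFabric (Option I) where
  strata := blowUpStrata F.strata J
  mem_of_subset := by
    intro J₁ J₂ h h₂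
    have he : J₁.eraseNone ⊆ J₂.eraseNone := fun x hx =>
      Finset.mem_eraseNone.2 (h (Finset.mem_eraseNone.1 hx))
    have key : ¬ J ⊆ J₂.eraseNone → ¬ J ⊆ J₁.eraseNone := fun hn hs => hn (hs.trans he)
    by_cases n₂ : none ∈ J₂
    · obtain ⟨a, b⟩ := (mem_blowUpStrata_of_none_mem n₂).1 h₂
      by_cases n₁ : none ∈ J₁
      · exact (mem_blowUpStrata_of_none_mem n₁).2
          ⟨F.mem_of_subset (Finset.union_subset_union_left he) a, key b⟩
      · exact (mem_blowUpStrata_of_none_notMem n₁).2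
          ⟨F.mem_of_subset (he.trans Finset.subset_union_left) a, key b⟩
    · obtain ⟨a, b⟩ := (mem_blowUpStrata_of_none_notMem n₂).1 h₂
      exact (mem_blowUpStrata_of_none_notMem fun n₁ => n₂ (h n₁)).2
        ⟨F.mem_of_subset he a, key b⟩

/-! ### Characteristic polyhedra -/

/-- The positive convex hull `[[A]]`, the convex hull of `A + ℝ_{≥0}^J`. -/
def posHull {ι : Type*} (A : Set (ι → ℝ)) : Set (ι → ℝ) :=
  convexHull ℝ (A + {τ : ι → ℝ | ∀ j, 0 ≤ τ j})

/-- `Δ` is a characteristic polyhedron with denominator `d`: `Δ = [[A]]` for some set `A` of points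
with coordinates in `(1/d) ℤ_{≥0}`. -/
def IsCharPolyhedron {ι : Type*} (d : ℕ) (Δ : Set (ι → ℝ)) : Prop :=
  ∃ A : Set (ι → ℝ), (∀ σ ∈ A, ∀ j, ∃ n : ℕ, σ j = (n : ℝ) / (d : ℝ)) ∧ Δ = posHull A

theorem subset_posHull {ι : Type*} (A : Set (ι → ℝ)) : A ⊆ posHull A := fun a ha =>
  subset_convexHull ℝ _ ⟨a, ha, 0, by simp, by simp⟩

theorem posHull_nonneg {ι : Type*} {A : Set (ι → ℝ)} (hA : ∀ σ ∈ A, ∀ j, 0 ≤ σ j) :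
    ∀ σ ∈ posHull A, ∀ j, 0 ≤ σ j := by
  intro σ hσ
  have hc : Convex ℝ {τ : ι → ℝ | ∀ j, 0 ≤ τ j} := fun x hx y hy a b ha hb _ j => by
    have := mul_nonneg ha (hx j)
    have := mul_nonneg hb (hy j)
    simp only [Pi.add_apply, Pi.smul_apply, smul_eq_mul]; linarith
  refine convexHull_min ?_ hc hσ
  rintro _ ⟨a, ha, t, ht, rfl⟩ j
  exact add_nonneg (hA a ha j) (ht j)

theorem IsCharPolyhedron.nonneg {ι : Type*} {d : ℕ} {Δ : Set (ι → ℝ)} (h : IsCharPolyhedron d Δ) :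
    ∀ σ ∈ Δ, ∀ j, 0 ≤ σ j := by
  obtain ⟨A, hA, rfl⟩ := h
  refine posHull_nonneg fun σ hσ j => ?_
  obtain ⟨n, hn⟩ := hA σ hσ j
  rw [hn]; positivity

theorem posHull_mono {ι : Type*} {A B : Set (ι → ℝ)} (h : A ⊆ B) : posHull A ⊆ posHull B :=
  convexHull_mono (Set.add_subset_add_right h)

theorem posHull_image_posHull {ι κ : Type*} (f : (ι → ℝ) →ₗ[ℝ] (κ → ℝ))
    (hf : ∀ τ : ι → ℝ, (∀ j, 0 ≤ τ j) → ∀ k, 0 ≤ f τ k) (A : Set (ι → ℝ)) :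
    posHull (f '' posHull A) = posHull (f '' A) := by
  refine Set.Subset.antisymm ?_ (posHull_mono (Set.image_mono (subset_posHull A)))
  refine convexHull_min ?_ (convex_convexHull ℝ _)
  have hadd : ∀ x ∈ posHull (f '' A), ∀ t : κ → ℝ, (∀ j, 0 ≤ t j) → x + t ∈ posHull (f '' A) := by
    intro x hx t ht
    have hc : Convex ℝ ((fun y => y + t) ⁻¹' posHull (f '' A)) :=
      (convex_convexHull ℝ _).translate_preimage_left t
    refine convexHull_min ?_ hc hx
    rintro _ ⟨a, ha, s, hs, rfl⟩
    exact subset_convexHull ℝ _ ⟨a, ha, s + t, fun j => add_nonneg (hs j) (ht j),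
      (add_assoc a s t).symm⟩
  have h1 : f '' posHull A ⊆ posHull (f '' A) := by
    unfold posHull
    rw [LinearMap.image_convexHull]
    refine convexHull_mono ?_
    rintro _ ⟨_, ⟨a, ha, t, ht, rfl⟩, rfl⟩
    exact ⟨f a, ⟨a, ha, rfl⟩, f t, hf t ht, (map_add f a t).symm⟩
  rintro _ ⟨x, hx, t, ht, rfl⟩
  exact hadd x (h1 hx) t ht

theorem posHull_posHull {ι : Type*} (A : Set (ι → ℝ)) : posHull (posHull A) = posHull A := by
  simpa using posHull_image_posHull (LinearMap.id : (ι → ℝ) →ₗ[ℝ] (ι → ℝ)) (fun _ h => h) A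

theorem image_posHull {ι κ : Type*} (f : (ι → ℝ) →ₗ[ℝ] (κ → ℝ))
    (hf : f '' {τ : ι → ℝ | ∀ j, 0 ≤ τ j} = {τ : κ → ℝ | ∀ j, 0 ≤ τ j}) (A : Set (ι → ℝ)) :
    f '' posHull A = posHull (f '' A) := by
  unfold posHull
  rw [LinearMap.image_convexHull, Set.image_add, hf]

theorem image_sub_posHull {ι : Type*} (e : ι → ℝ) (A : Set (ι → ℝ)) :
    (fun σ => σ - e) '' posHull A = posHull ((fun σ => σ - e) '' A) := by
  have h : ∀ B : Set (ι → ℝ), (fun σ => σ - e) '' B = (-e) +ᵥ B := fun B => by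
    simp only [sub_eq_neg_add]; rfl
  unfold posHull
  rw [h, h, ← convexHull_vadd]
  congr 1
  ext x
  simp only [Set.mem_vadd_set, Set.mem_add, vadd_eq_add]
  constructor
  · rintro ⟨_, ⟨a, ha, t, ht, rfl⟩, rfl⟩
    exact ⟨_, ⟨a, ha, rfl⟩, t, ht, by abel⟩
  · rintro ⟨_, ⟨a, ha, rfl⟩, t, ht, rfl⟩
    exact ⟨_, ⟨a, ha, t, ht, rfl⟩, by abel⟩

/-! ### Polyhedra systems, contact exponent and singular locus -/

/-- The contact exponent `δ(Δ)` of a (non-empty) polyhedron `Δ ⊆ ℝ_{≥0}^J`: the minimum of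
`|σ| = ∑ j, σ j` over `σ ∈ Δ` if `J ≠ ∅`, and `-1` by convention if `J = ∅`. -/
noncomputable def contactExponent {I : Type u} {J : Finset I} (Δ : Set (J → ℝ)) : ℝ :=
  open Classical in if J = ∅ then -1 else sInf ((fun σ : J → ℝ => ∑ j, σ j) '' Δ)

/-- A polyhedra system `(F; {Δ_J}_{J ∈ H}, d)`, all of whose polyhedra are non-empty. Only the
values of `Δ` at strata are meaningful. -/
structure PolyhedraSystem (I : Type u) where
  fabric : SupportFabric I
  d : ℕ
  d_pos : 0 < d
  Δ : ∀ J : Finset I, Set (J → ℝ)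
  isCharPolyhedron : ∀ J ∈ fabric.strata, IsCharPolyhedron d (Δ J)
  nonempty : ∀ J ∈ fabric.strata, (Δ J).Nonempty
  proj : ∀ (J₁ J₂ : Finset I) (h : J₁ ⊆ J₂), J₂ ∈ fabric.strata →
    Δ J₁ = Finset.restrict₂ (π := fun _ => ℝ) h '' Δ J₂

/-- The singular locus: the set of strata `J` with `δ(Δ_J) ≥ 1`. -/
def PolyhedraSystem.Sing {I : Type u} (D : PolyhedraSystem I) : Set (Finset I) :=
  {J | J ∈ D.fabric.strata ∧ 1 ≤ contactExponent (D.Δ J)}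

theorem IsCharPolyhedron.isLeast_contactExponent {I : Type u} {J : Finset I} {d : ℕ} (hd : 0 < d)
    {Δ : Set (J → ℝ)} (h : IsCharPolyhedron d Δ) (hne : Δ.Nonempty) (hJ : J ≠ ∅) :
    IsLeast ((fun σ : J → ℝ => ∑ j, σ j) '' Δ) (contactExponent Δ) := by
  have hδ : contactExponent Δ = sInf ((fun σ : J → ℝ => ∑ j, σ j) '' Δ) := if_neg hJ
  obtain ⟨A, hA, rfl⟩ := h
  have hAne : A.Nonempty := by
    by_contra hc
    rw [Set.not_nonempty_iff_eq_empty] at hc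
    subst hc
    simp [posHull] at hne
  have hdR : (0 : ℝ) < d := by exact_mod_cast hd
  have hnat : ∀ σ ∈ A, ∃ n : ℕ, ∑ j, σ j = (n : ℝ) / d := by
    intro σ hσ
    choose n hn using hA σ hσ
    exact ⟨∑ j, n j, by rw [Nat.cast_sum, Finset.sum_div]; exact Finset.sum_congr rfl fun j _ => hn j⟩
  classical
  have hex : ∃ n : ℕ, ∃ σ ∈ A, ∑ j, σ j = (n : ℝ) / d := by
    obtain ⟨σ, hσ⟩ := hAne
    obtain ⟨n, hn⟩ := hnat σ hσ
    exact ⟨n, σ, hσ, hn⟩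
  obtain ⟨σ₀, hσ₀, h₀⟩ := Nat.find_spec hex
  have hleast : IsLeast ((fun σ : J → ℝ => ∑ j, σ j) '' posHull A) (∑ j, σ₀ j) := by
    refine ⟨⟨σ₀, subset_posHull A hσ₀, rfl⟩, ?_⟩
    rintro _ ⟨σ, hσ, rfl⟩
    have hc : Convex ℝ {τ : J → ℝ | ∑ j, σ₀ j ≤ ∑ j, τ j} :=
      convex_halfSpace_ge (f := fun τ : J → ℝ => ∑ j, τ j)
        ⟨fun x y => by simp [Finset.sum_add_distrib], fun c x => by simp [Finset.mul_sum]⟩ _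
    refine convexHull_min ?_ hc hσ
    rintro _ ⟨a, ha, t, ht, rfl⟩
    obtain ⟨n, hn⟩ := hnat a ha
    have h1 : ∑ j, σ₀ j ≤ ∑ j, a j := by
      rw [h₀, hn]
      have : Nat.find hex ≤ n := Nat.find_min' hex ⟨a, ha, hn⟩
      gcongr
    have h2 : 0 ≤ ∑ j, t j := Finset.sum_nonneg fun j _ => ht j
    simp only [Set.mem_ofPred_eq, Pi.add_apply, Finset.sum_add_distrib]
    linarith
  rw [hδ, hleast.csInf_eq]
  exact hleast

theorem PolyhedraSystem.one_le_of_mem_Sing {I : Type u} {D : PolyhedraSystem I} {J : Finset I}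
    (hJ : J ∈ D.Sing) : ∀ σ ∈ D.Δ J, 1 ≤ ∑ j, σ j := by
  intro σ hσ
  have hne : J ≠ ∅ := by
    intro h
    have := hJ.2
    rw [contactExponent, if_pos h] at this
    linarith
  have := (D.isCharPolyhedron J hJ.1).isLeast_contactExponent D.d_pos (D.nonempty J hJ.1) hne
  exact hJ.2.trans (this.2 ⟨σ, hσ, rfl⟩)

/-! ### Transforms under blow-ups -/

/-- For `J' = (K \ J) ∪ A ∪ {∞}` with `J ⊆ K` and `A ⊊ J` (so that `K = (J' \ {∞}) ∪ J`), the map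
`λ_{J'} : ℝ^K → ℝ^{J'}` which keeps the coordinates other than `∞` and has
`λ_{J'}(σ)(∞) = ∑ j ∈ J, σ j`. -/
def lam {I : Type u} [DecidableEq I] (J : Finset I) (J' : Finset (Option I))
    (σ : ↥(J'.eraseNone ∪ J) → ℝ) : J' → ℝ
  | ⟨none, _⟩ => ∑ i : J, σ ⟨i.1, Finset.mem_union_right _ i.2⟩
  | ⟨some i, h⟩ => σ ⟨i, Finset.mem_union_left _ (Finset.mem_eraseNone.2 h)⟩

/-- Forgetting the coordinate `∞`; for `∞ ∉ J'` this is the identification of `ℝ^{J'}` for `J'` as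
a subset of `I ∪ {∞}` with `ℝ^{J'}` for `J'` as a subset of `I`. -/
def dropNone {I : Type u} (J' : Finset (Option I)) :
    (J' → ℝ) →ₗ[ℝ] (J'.eraseNone → ℝ) where
  toFun σ i := σ ⟨some i.1, Finset.mem_eraseNone.1 i.2⟩
  map_add' _ _ := rfl
  map_smul' _ _ := rfl

/-- The polyhedra `Δ⁰_{J'}` of the total transform centered in `J`: `Δ_{J'}` if `∞ ∉ J'` and
`[[λ_{J'}(Δ_K)]]`, `K = (J' \ {∞}) ∪ J`, if `∞ ∈ J'`. -/
def PolyhedraSystem.totalΔ {I : Type u} [DecidableEq I] (D : PolyhedraSystem I) (J : Finset I)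
    (J' : Finset (Option I)) : Set (J' → ℝ) :=
  if none ∈ J' then posHull (lam J J' '' D.Δ (J'.eraseNone ∪ J))
  else dropNone J' ⁻¹' D.Δ J'.eraseNone

/-- The vector `e_{J',∞}`, the restriction to `J'` of the `∞`-th vector of the standard basis. -/
def eInfty {I : Type u} (J' : Finset (Option I)) : J' → ℝ
  | ⟨none, _⟩ => 1
  | ⟨some _, _⟩ => 0

/-- The polyhedra `Δ'_{J'} = Δ⁰_{J'} - e_{J',∞}` of the characteristic transform centered in `J`. -/
def PolyhedraSystem.charΔ {I : Type u} [DecidableEq I] (D : PolyhedraSystem I) (J : Finset I)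
    (J' : Finset (Option I)) : Set (J' → ℝ) :=
  (fun σ => σ - eInfty J') '' D.totalΔ J J'

theorem dropNone_bijective {I : Type u} {J' : Finset (Option I)} (h : none ∉ J') :
    Function.Bijective (dropNone J') := by
  constructor
  · intro σ τ hst
    funext ⟨j, hj⟩
    cases j with
    | none => exact absurd hj h
    | some i => exact congrFun hst ⟨i, Finset.mem_eraseNone.2 hj⟩
  · intro σ
    refine ⟨fun j => match j with
      | ⟨none, _⟩ => 0
      | ⟨some i, hi⟩ => σ ⟨i, Finset.mem_eraseNone.2 hi⟩, ?_⟩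
    rfl

/-- `lam` as a linear map. -/
def lamLin {I : Type u} [DecidableEq I] (J : Finset I) (J' : Finset (Option I)) :
    (↥(J'.eraseNone ∪ J) → ℝ) →ₗ[ℝ] (J' → ℝ) where
  toFun := lam J J'
  map_add' σ τ := by
    funext ⟨j, hj⟩
    cases j with
    | none => simp [lam, Finset.sum_add_distrib]
    | some i => simp [lam]
  map_smul' c σ := by
    funext ⟨j, hj⟩
    cases j with
    | none => simp [lam, Finset.mul_sum]
    | some i => simp [lam]

theorem lamLin_nonneg {I : Type u} [DecidableEq I] (J : Finset I) (J' : Finset (Option I))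
    (τ : ↥(J'.eraseNone ∪ J) → ℝ) (hτ : ∀ j, 0 ≤ τ j) : ∀ k, 0 ≤ lamLin J J' τ k := by
  rintro ⟨j, hj⟩
  cases j with
  | none => exact Finset.sum_nonneg fun i _ => hτ _
  | some i => exact hτ _

/-- Restriction of functions from `J₂` to `J₁` as a linear map. -/
def restrictLin {I : Type u} {J₁ J₂ : Finset I} (h : J₁ ⊆ J₂) : (J₂ → ℝ) →ₗ[ℝ] (J₁ → ℝ) where
  toFun := Finset.restrict₂ (π := fun _ => ℝ) h
  map_add' _ _ := rfl
  map_smul' _ _ := rfl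

theorem restrictLin_image_nonneg {I : Type u} {J₁ J₂ : Finset I} (h : J₁ ⊆ J₂) :
    restrictLin h '' {τ : J₂ → ℝ | ∀ j, 0 ≤ τ j} = {τ : J₁ → ℝ | ∀ j, 0 ≤ τ j} := by
  classical
  ext τ
  constructor
  · rintro ⟨σ, hσ, rfl⟩ j
    exact hσ _
  · intro hτ
    refine ⟨fun j => if hj : j.1 ∈ J₁ then τ ⟨j.1, hj⟩ else 0, fun j => ?_, ?_⟩
    · by_cases hj : j.1 ∈ J₁
      · simpa [hj] using hτ _
      · simp [hj]
    · funext j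
      exact dif_pos j.2

theorem dropNone_image_nonneg {I : Type u} {J' : Finset (Option I)} :
    dropNone J' '' {τ : J' → ℝ | ∀ j, 0 ≤ τ j} = {τ : J'.eraseNone → ℝ | ∀ j, 0 ≤ τ j} := by
  ext τ
  constructor
  · rintro ⟨σ, hσ, rfl⟩ j
    exact hσ _
  · intro hτ
    refine ⟨fun j => match j with
      | ⟨none, _⟩ => 0
      | ⟨some i, hi⟩ => τ ⟨i, Finset.mem_eraseNone.2 hi⟩, ?_, rfl⟩
    rintro ⟨j, hj⟩
    cases j with
    | none => exact le_rfl
    | some i => exact hτ _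

theorem PolyhedraSystem.posHull_Δ {I : Type u} (D : PolyhedraSystem I) {J : Finset I}
    (hJ : J ∈ D.fabric.strata) : posHull (D.Δ J) = D.Δ J := by
  obtain ⟨A, -, h⟩ := D.isCharPolyhedron J hJ
  rw [h, posHull_posHull]

theorem PolyhedraSystem.totalΔ_proj {I : Type u} [DecidableEq I] (D : PolyhedraSystem I) (J : Finset I)
    (J₁ J₂ : Finset (Option I)) (h : J₁ ⊆ J₂)
    (h₂ : J₂ ∈ (D.fabric.blowUp J).strata) :
    D.totalΔ J J₁ = restrictLin h '' D.totalΔ J J₂ := by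
  have he : J₁.eraseNone ⊆ J₂.eraseNone := fun x hx =>
    Finset.mem_eraseNone.2 (h (Finset.mem_eraseNone.1 hx))
  by_cases n₂ : none ∈ J₂
  · have hK := ((mem_blowUpStrata_of_none_mem n₂).1 h₂).1
    by_cases n₁ : none ∈ J₁
    · rw [totalΔ, totalΔ, if_pos n₁, if_pos n₂, image_posHull _ (restrictLin_image_nonneg h),
        D.proj _ _ (Finset.union_subset_union_left he) hK, Set.image_image, Set.image_image]
      congr 2
      funext σ
      funext ⟨j, hj⟩
      cases j with
      | none => rfl
      | some i => rfl
    · rw [totalΔ, totalΔ, if_neg n₁, if_pos n₂]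
      apply Function.Injective.image_injective (dropNone_bijective n₁).1
      rw [Set.image_preimage_eq _ (dropNone_bijective n₁).2,
        image_posHull _ (restrictLin_image_nonneg h), image_posHull _ dropNone_image_nonneg]
      have hL := he.trans (Finset.subset_union_left (s₂ := J))
      rw [← D.posHull_Δ (D.fabric.mem_of_subset hL hK), D.proj _ _ hL hK, Set.image_image,
        Set.image_image]
      rfl
  · have n₁ : none ∉ J₁ := fun n₁ => n₂ (h n₁)
    have hL := ((mem_blowUpStrata_of_none_notMem n₂).1 h₂).1
    rw [totalΔ, totalΔ, if_neg n₁, if_neg n₂]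
    apply Function.Injective.image_injective (dropNone_bijective n₁).1
    rw [Set.image_preimage_eq _ (dropNone_bijective n₁).2, Set.image_image, D.proj _ _ he hL]
    conv_lhs => rw [← Set.image_preimage_eq (D.Δ J₂.eraseNone) (dropNone_bijective n₂).2,
      Set.image_image]
    rfl

theorem PolyhedraSystem.totalΔ_nonempty {I : Type u} [DecidableEq I] (D : PolyhedraSystem I) (J : Finset I)
    (J' : Finset (Option I)) (h : J' ∈ (D.fabric.blowUp J).strata) :
    (D.totalΔ J J').Nonempty := by
  by_cases n : none ∈ J'
  · have hK := ((mem_blowUpStrata_of_none_mem n).1 h).1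
    rw [totalΔ, if_pos n]
    exact ((D.nonempty _ hK).image _).mono (subset_posHull _)
  · have hL := ((mem_blowUpStrata_of_none_notMem n).1 h).1
    rw [totalΔ, if_neg n]
    exact (D.nonempty _ hL).preimage (dropNone_bijective n).2

theorem PolyhedraSystem.charΔ_isCharPolyhedron {I : Type u} [DecidableEq I] (D : PolyhedraSystem I)
    (J : Finset I) (hJ : J ∈ D.Sing) (J' : Finset (Option I))
    (h : J' ∈ (D.fabric.blowUp J).strata) : IsCharPolyhedron D.d (D.charΔ J J') := by
  have hd : (0 : ℝ) < D.d := by exact_mod_cast D.d_pos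
  by_cases n : none ∈ J'
  · have hK := ((mem_blowUpStrata_of_none_mem n).1 h).1
    obtain ⟨A, hA, hΔ⟩ := D.isCharPolyhedron _ hK
    refine ⟨(fun σ => σ - eInfty J') '' (lam J J' '' A), ?_, ?_⟩
    · rintro _ ⟨_, ⟨a, ha, rfl⟩, rfl⟩ ⟨j, hj⟩
      choose m hm using hA a ha
      cases j with
      | none =>
        have hmem : Finset.restrict₂ (π := fun _ => ℝ) Finset.subset_union_right a ∈ D.Δ J := by
          rw [D.proj _ _ Finset.subset_union_right hK]
          exact ⟨a, hΔ ▸ subset_posHull A ha, rfl⟩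
        have h1 : 1 ≤ ∑ i : J, a ⟨i.1, Finset.mem_union_right _ i.2⟩ :=
          D.one_le_of_mem_Sing hJ _ hmem
        have h2 : ∑ i : J, a ⟨i.1, Finset.mem_union_right _ i.2⟩ =
            ((∑ i : J, m ⟨i.1, Finset.mem_union_right _ i.2⟩ : ℕ) : ℝ) / D.d := by
          rw [Nat.cast_sum, Finset.sum_div]
          exact Finset.sum_congr rfl fun i _ => hm _
        rw [h2, le_div_iff₀ hd, one_mul] at h1
        have h3 := Nat.cast_le.1 h1
        refine ⟨(∑ i : J, m ⟨i.1, Finset.mem_union_right _ i.2⟩) - D.d, ?_⟩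
        rw [Nat.cast_sub h3, sub_div, ← h2, div_self hd.ne']
        rfl
      | some i =>
        refine ⟨m ⟨i, Finset.mem_union_left _ (Finset.mem_eraseNone.2 hj)⟩, ?_⟩
        rw [← hm]
        simp [lam, eInfty]
    · rw [charΔ, totalΔ, if_pos n, hΔ, ← image_sub_posHull]
      congr 1
      exact posHull_image_posHull (lamLin J J') (lamLin_nonneg J J') A
  · have hL := ((mem_blowUpStrata_of_none_notMem n).1 h).1
    obtain ⟨A, hA, hΔ⟩ := D.isCharPolyhedron _ hL
    have e0 : eInfty J' = 0 := by
      funext ⟨j, hj⟩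
      cases j with
      | none => exact absurd hj n
      | some i => rfl
    refine ⟨dropNone J' ⁻¹' A, ?_, ?_⟩
    · rintro σ hσ ⟨j, hj⟩
      cases j with
      | none => exact absurd hj n
      | some i => exact hA _ hσ ⟨i, Finset.mem_eraseNone.2 hj⟩
    · rw [charΔ, totalΔ, if_neg n, e0]
      simp only [sub_zero, Set.image_id']
      apply Function.Injective.image_injective (dropNone_bijective n).1
      rw [image_posHull _ dropNone_image_nonneg, Set.image_preimage_eq _ (dropNone_bijective n).2,
        Set.image_preimage_eq _ (dropNone_bijective n).2, hΔ]

theorem PolyhedraSystem.charΔ_proj {I : Type u} [DecidableEq I] (D : PolyhedraSystem I) (J : Finset I)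
    (J₁ J₂ : Finset (Option I)) (h : J₁ ⊆ J₂)
    (h₂ : J₂ ∈ (D.fabric.blowUp J).strata) :
    D.charΔ J J₁ = restrictLin h '' D.charΔ J J₂ := by
  rw [charΔ, charΔ, D.totalΔ_proj J J₁ J₂ h h₂, Set.image_image, Set.image_image]
  congr 1
  funext σ
  rw [map_sub]
  congr 1
  funext ⟨j, hj⟩
  cases j with
  | none => rfl
  | some i => rfl

/-- The characteristic transform `Λ_J(D)` of `D` centered in a singular stratum `J`. -/
def PolyhedraSystem.charTransform {I : Type u} [DecidableEq I] (D : PolyhedraSystem I) (J : Finset I)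
    (hJ : J ∈ D.Sing) : PolyhedraSystem (Option I) where
  fabric := D.fabric.blowUp J
  d := D.d
  d_pos := D.d_pos
  Δ := D.charΔ J
  isCharPolyhedron := D.charΔ_isCharPolyhedron J hJ
  nonempty J' h := (D.totalΔ_nonempty J J' h).image _
  proj J₁ J₂ h h₂ := D.charΔ_proj J J₁ J₂ h h₂

/-- `FiniteCharSeq D D'`: there is a finite sequence `D → D₁ → ⋯ → D_k = D'` (`k ≥ 0`) of
characteristic transforms, each centered in a singular stratum of the preceding system. -/
inductive FiniteCharSeq {I : Type u} [DecidableEq I] (D : PolyhedraSystem I) :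
    ∀ {I' : Type u} [DecidableEq I'], PolyhedraSystem I' → Prop
  | refl : FiniteCharSeq D D
  | step {I' : Type u} [DecidableEq I'] {D' : PolyhedraSystem I'} (h : FiniteCharSeq D D')
      (J : Finset I') (hJ : J ∈ D'.Sing) : FiniteCharSeq D (D'.charTransform J hJ)

end PolyhedraSystems

/-! The polyhedra are replaced by sets of integer exponents, their lattice points scaled by `d`. A
stratum is then singular when all its exponents have order (coordinate sum over the stratum) at
least `m = d`, and a characteristic transform puts `∑ j ∈ J, a j - m` in the new coordinate. This is
the monomial shadow of an idealistic exponent, and Hironaka's strategy applies: induction on the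
size of the strata, which blow-ups never increase (`card_le_card_below`).

Monomial case: if one exponent `ω` generates along the singular strata, blowing up a minimal
singular stratum lowers the multiset of orders (`IsMonomial.resolvable`).

Maximal contact: if every singular stratum carries an exponent of order at most `m`, some index `i`
in its support persists in all singular strata above it. Projecting from `i` gives a coefficient
system on the link of `i`, with smaller strata and denominator `m!`. A resolution of it, lifted by
adding `i` to each centre, removes `i` from the list of contact indices (`IsCovered.resolvable`).

General case: write the system as a monomial `ω` times a system `N` whose order is at most `r` on
the singular locus. The companion system is singular exactly where the product is singular and `N`
has order at least `r`. It falls under maximal contact, and resolving it lowers `r`, down to the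
monomial case (`IsShift.resolvable`). -/

namespace PolyhedraSystems

open Finset

/-! ### Strata of a blow-up -/

section Below

variable {I : Type u} [DecidableEq I] {J : Finset I} {J' : Finset (Option I)}

/-- The stratum of a fabric which carries the stratum `J'` of its blow-up centered in `J`. -/
def below (J : Finset I) (J' : Finset (Option I)) : Finset I :=
  if none ∈ J' then J'.eraseNone ∪ J else J'.eraseNone

theorem below_of_mem (h : none ∈ J') : below J J' = J'.eraseNone ∪ J := if_pos h

theorem below_of_notMem (h : none ∉ J') : below J J' = J'.eraseNone := if_neg h

theorem mem_below {i : I} : i ∈ below J J' ↔ some i ∈ J' ∨ none ∈ J' ∧ i ∈ J := by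
  by_cases h : none ∈ J' <;> simp [below, h]

theorem eraseNone_subset_below : J'.eraseNone ⊆ below J J' := fun _ hi =>
  mem_below.2 (Or.inl (mem_eraseNone.1 hi))

theorem subset_below (h : none ∈ J') : J ⊆ below J J' := fun _ hi => mem_below.2 (Or.inr ⟨h, hi⟩)

theorem below_mono {J₁ J₂ : Finset (Option I)} (h : J₁ ⊆ J₂) : below J J₁ ⊆ below J J₂ := by
  intro i
  rw [mem_below, mem_below]
  exact Or.imp (fun hi => h hi) fun hi => ⟨h hi.1, hi.2⟩

theorem SupportFabric.mem_blowUp {F : SupportFabric I} :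
    J' ∈ (F.blowUp J).strata ↔ below J J' ∈ F.strata ∧ ¬ J ⊆ J'.eraseNone := by
  by_cases h : none ∈ J'
  · rw [below_of_mem h]; exact mem_blowUpStrata_of_none_mem h
  · rw [below_of_notMem h]; exact mem_blowUpStrata_of_none_notMem h

theorem sum_of_none_mem (h : none ∈ J') (f : Option I → ℕ) :
    ∑ k ∈ J', f k = f none + ∑ i ∈ J'.eraseNone, f (some i) := by
  conv_lhs => rw [← insert_eq_self.2 h, ← insertNone_eraseNone]
  exact sum_insertNone f _

theorem sum_of_none_notMem (h : none ∉ J') (f : Option I → ℕ) :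
    ∑ k ∈ J', f k = ∑ i ∈ J'.eraseNone, f (some i) := by
  conv_lhs => rw [← erase_eq_of_notMem h, ← map_some_eraseNone, sum_map]
  rfl

/-- A stratum through `∞` misses some element of `J`, which makes up for the new index. Hence
blow-ups preserve the bound on the size of strata used in the main induction. -/
theorem card_le_card_below (h : ¬ J ⊆ J'.eraseNone) : J'.card ≤ (below J J').card := by
  by_cases hn : none ∈ J'
  · have h1 : J'.eraseNone ⊂ below J J' := by
      refine ⟨eraseNone_subset_below, fun hs => h ((subset_below hn).trans hs)⟩
    have h2 := card_lt_card h1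
    rw [card_eraseNone_of_mem hn] at h2
    omega
  · rw [below_of_notMem hn, card_eraseNone_eq_card_erase, erase_eq_of_notMem hn]

end Below

/-! ### Domination between sets of exponents -/

/-- Every exponent of `A` is at least some exponent of `B` on the coordinates in `K`. -/
def Dominates {I : Type u} (K : Finset I) (A B : Set (I → ℕ)) : Prop :=
  ∀ a ∈ A, ∃ b ∈ B, ∀ k ∈ K, b k ≤ a k

section Dominates

variable {I : Type u} {K : Finset I} {A B C : Set (I → ℕ)}

theorem Dominates.refl (K : Finset I) (A : Set (I → ℕ)) : Dominates K A A := fun a ha =>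
  ⟨a, ha, fun _ _ => le_rfl⟩

theorem Dominates.trans (h : Dominates K A B) (h' : Dominates K B C) : Dominates K A C := by
  intro a ha
  obtain ⟨b, hb, hab⟩ := h a ha
  obtain ⟨c, hc, hbc⟩ := h' b hb
  exact ⟨c, hc, fun k hk => (hbc k hk).trans (hab k hk)⟩

theorem Dominates.union {A' B' : Set (I → ℕ)} (h : Dominates K A B) (h' : Dominates K A' B') :
    Dominates K (A ∪ A') (B ∪ B') := by
  rintro a (ha | ha)
  · exact (h a ha).imp fun _ hb => ⟨Or.inl hb.1, hb.2⟩
  · exact (h' a ha).imp fun _ hb => ⟨Or.inr hb.1, hb.2⟩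

theorem Dominates.image_image {κ : Type u} {f g : (I → ℕ) → κ → ℕ} {M : Finset κ}
    (h : Dominates K A B)
    (hfg : ∀ a ∈ A, ∀ b ∈ B, (∀ k ∈ K, b k ≤ a k) → ∀ j ∈ M, g b j ≤ f a j) :
    Dominates M (f '' A) (g '' B) := by
  rintro _ ⟨a, ha, rfl⟩
  obtain ⟨b, hb, hab⟩ := h a ha
  exact ⟨_, ⟨b, hb, rfl⟩, hfg a ha b hb hab⟩

theorem dominates_image {κ : Type u} {f g : (I → ℕ) → κ → ℕ} {M : Finset κ}
    (hfg : ∀ a ∈ A, ∀ j ∈ M, g a j ≤ f a j) : Dominates M (f '' A) (g '' A) := by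
  rintro _ ⟨a, ha, rfl⟩
  exact ⟨_, ⟨a, ha, rfl⟩, hfg a ha⟩

theorem Dominates.le_sum (h : Dominates K A B) {m : ℕ} (hB : ∀ b ∈ B, m ≤ ∑ k ∈ K, b k) :
    ∀ a ∈ A, m ≤ ∑ k ∈ K, a k := by
  intro a ha
  obtain ⟨b, hb, hab⟩ := h a ha
  exact (hB b hb).trans (sum_le_sum hab)

end Dominates

/-! ### Exponent systems -/

/-- A discrete model of a polyhedra system: each stratum `K` carries a non-empty set of exponents,
of which only the coordinates in `K` are meaningful. The denominator is kept apart. -/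
structure ExponentSystem (I : Type u) where
  fabric : SupportFabric I
  exps : Finset I → Set (I → ℕ)
  nonempty : ∀ K ∈ fabric.strata, (exps K).Nonempty
  -- With `extend`, this says that both sets generate the same up-closed set in the coordinates of
  -- `J`: the discrete form of the projection condition.
  restrict : ∀ ⦃J K : Finset I⦄, J ⊆ K → K ∈ fabric.strata → Dominates J (exps K) (exps J)
  extend : ∀ ⦃J K : Finset I⦄, J ⊆ K → K ∈ fabric.strata → Dominates J (exps J) (exps K)

/-- The singular locus of an exponent system with respect to the denominator `m`. -/
def ExponentSystem.Sing {I : Type u} (m : ℕ) (X : ExponentSystem I) : Set (Finset I) :=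
  {K | K ∈ X.fabric.strata ∧ ∀ a ∈ X.exps K, m ≤ ∑ k ∈ K, a k}

/-- The transform of an exponent under a blow-up centered in `J`, with denominator `m`. -/
def transformExp {I : Type u} (m : ℕ) (J : Finset I) (a : I → ℕ) : Option I → ℕ
  -- The truncated subtraction is exact for exponents on strata containing a singular centre `J`, by
  -- `le_sum_of_subset`; truncation keeps the map monotone for all exponents.
  | none => ∑ j ∈ J, a j - m
  | some i => a i

section Transform

variable {I : Type u} {m : ℕ} {J K : Finset I} {J' : Finset (Option I)}

@[simp]
theorem transformExp_none (a : I → ℕ) : transformExp m J a none = ∑ j ∈ J, a j - m := rfl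

@[simp]
theorem transformExp_some (a : I → ℕ) (i : I) : transformExp m J a (some i) = a i := rfl

theorem ExponentSystem.le_sum_of_subset {X : ExponentSystem I} (hJ : J ∈ X.Sing m) (hJK : J ⊆ K)
    (hK : K ∈ X.fabric.strata) : ∀ a ∈ X.exps K, m ≤ ∑ j ∈ J, a j :=
  (X.restrict hJK hK).le_sum hJ.2

theorem ExponentSystem.mem_sing_of_subset {X : ExponentSystem I} (hJ : J ∈ X.Sing m) (hJK : J ⊆ K)
    (hK : K ∈ X.fabric.strata) : K ∈ X.Sing m :=
  ⟨hK, fun a ha => (X.le_sum_of_subset hJ hJK hK a ha).trans (sum_le_sum_of_subset hJK)⟩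

variable [DecidableEq I]

theorem transformExp_mono {a b : I → ℕ} (h : ∀ k ∈ below J J', b k ≤ a k) :
    ∀ k ∈ J', transformExp m J b k ≤ transformExp m J a k := by
  rintro (_ | i) hk
  · exact Nat.sub_le_sub_right (sum_le_sum fun j hj => h j (subset_below hk hj)) m
  · exact h i (eraseNone_subset_below (mem_eraseNone.2 hk))

theorem Dominates.transform {A B : Set (I → ℕ)} (h : Dominates (below J J') A B) :
    Dominates J' (transformExp m J '' A) (transformExp m J '' B) :=
  h.image_image fun _ _ _ _ hab => transformExp_mono hab

/-- The characteristic transform of an exponent system centered in `J`, with denominator `m`. -/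
def ExponentSystem.blowUp (m : ℕ) (J : Finset I) (X : ExponentSystem I) :
    ExponentSystem (Option I) where
  fabric := X.fabric.blowUp J
  exps J' := transformExp m J '' X.exps (below J J')
  nonempty _ h := (X.nonempty _ (SupportFabric.mem_blowUp.1 h).1).image _
  restrict J₁ J₂ h h₂ := by
    have hb := below_mono (J := J) h
    exact (X.restrict hb (SupportFabric.mem_blowUp.1 h₂).1).transform
  extend J₁ J₂ h h₂ := by
    have hb := below_mono (J := J) h
    exact (X.extend hb (SupportFabric.mem_blowUp.1 h₂).1).transform

/-- Through `∞`, the stratum below contains the singular centre, and singularity passes to larger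
strata; away from `∞`, the orders are unchanged. -/
theorem ExponentSystem.below_mem_sing {X : ExponentSystem I} (hJ : J ∈ X.Sing m)
    (hJ' : J' ∈ (X.blowUp m J).Sing m) : below J J' ∈ X.Sing m := by
  have hK := (SupportFabric.mem_blowUp.1 hJ'.1).1
  by_cases hn : none ∈ J'
  · exact mem_sing_of_subset hJ (subset_below hn) hK
  · refine ⟨hK, fun a ha => ?_⟩
    have := hJ'.2 _ ⟨a, ha, rfl⟩
    rw [sum_of_none_notMem hn] at this
    rwa [below_of_notMem hn]

/-- If the exponent `a` has order at most `m` along `K` and at least `m` along `J ⊆ K`, then it is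
supported in `J`. -/
theorem sum_eq_and_eq_zero_of_le {a : I → ℕ} {r : ℕ} (hJK : J ⊆ K) (h₁ : r ≤ ∑ j ∈ J, a j)
    (h₂ : ∑ k ∈ K, a k ≤ r) : ∑ j ∈ J, a j = r ∧ ∀ k ∈ K, k ∉ J → a k = 0 := by
  have h3 := sum_sdiff (f := a) hJK
  refine ⟨by omega, fun k hk hkJ => ?_⟩
  have : ∑ k ∈ K \ J, a k = 0 := by omega
  exact (sum_eq_zero_iff.1 this) k (mem_sdiff.2 ⟨hk, hkJ⟩)

/-- Along a centre inside the stratum below, the order is squeezed to exactly `r`, so the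
exceptional coordinate is `r - r = 0`. This is why order does not increase under permissible
blow-ups. -/
theorem sum_transformExp_le {a : I → ℕ} {r : ℕ} (hr : none ∈ J' → r ≤ ∑ j ∈ J, a j)
    (h : ∑ k ∈ below J J', a k ≤ r) :
    ∑ k ∈ J', transformExp r J a k ≤ ∑ i ∈ J'.eraseNone, a i := by
  by_cases hn : none ∈ J'
  · have := (sum_eq_and_eq_zero_of_le (subset_below hn) (hr hn) h).1
    rw [sum_of_none_mem hn]
    simp [this]
  · rw [sum_of_none_notMem hn]; rfl

end Transform

/-- The exponent system can be made non-singular by finitely many characteristic transforms. -/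
inductive Resolvable (m : ℕ) : ∀ {I : Type u} [DecidableEq I], ExponentSystem I → Prop
  | of_sing_eq_empty {I : Type u} [DecidableEq I] (X : ExponentSystem I) (h : X.Sing m = ∅) :
      Resolvable m X
  | of_blowUp {I : Type u} [DecidableEq I] (X : ExponentSystem I) (J : Finset I)
      (hJ : J ∈ X.Sing m) (h : Resolvable m (X.blowUp m J)) : Resolvable m X

/-- A resolution of `X` can be lifted along a relation which is stable under blow-ups. -/
theorem Resolvable.lift {m m' : ℕ}
    (Rel : ∀ {I : Type u} [DecidableEq I], ExponentSystem I → ExponentSystem I → Prop)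
    (step : ∀ {I : Type u} [DecidableEq I] (X Y : ExponentSystem I) (J : Finset I), Rel X Y →
      J ∈ X.Sing m → ∃ J' ∈ Y.Sing m', Rel (X.blowUp m J) (Y.blowUp m' J'))
    (final : ∀ {I : Type u} [DecidableEq I] (X Y : ExponentSystem I), Rel X Y → X.Sing m = ∅ →
      Resolvable m' Y)
    {I : Type u} [DecidableEq I] {X : ExponentSystem I} (hX : Resolvable m X) :
    ∀ {Y : ExponentSystem I}, Rel X Y → Resolvable m' Y := by
  induction hX with
  | of_sing_eq_empty X h => exact fun hR => final _ _ hR h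
  | of_blowUp X J hJ _ ih =>
    intro Y hR
    obtain ⟨J', hJ', hR'⟩ := step _ _ _ hR hJ
    exact .of_blowUp _ J' hJ' (ih hR')

/-! ### Monomial systems -/

/-- The exponents of `X` are bounded below by `ω`, and `ω` is attained along the singular strata. -/
structure ExponentSystem.IsMonomial {I : Type u} (m : ℕ) (X : ExponentSystem I) (ω : I → ℕ) :
    Prop where
  le : ∀ K ∈ X.fabric.strata, ∀ a ∈ X.exps K, ∀ k ∈ K, ω k ≤ a k
  attained : ∀ K ∈ X.Sing m, ∃ a ∈ X.exps K, ∀ k ∈ K, a k ≤ ω k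

section Monomial

variable {I : Type u} {m : ℕ} {X : ExponentSystem I} {ω : I → ℕ}

theorem ExponentSystem.IsMonomial.mem_sing_iff (h : X.IsMonomial m ω) {K : Finset I}
    (hK : K ∈ X.fabric.strata) : K ∈ X.Sing m ↔ m ≤ ∑ k ∈ K, ω k := by
  constructor
  · intro hS
    obtain ⟨a, ha, haω⟩ := h.attained K hS
    exact (hS.2 a ha).trans (sum_le_sum haω)
  · exact fun hm => ⟨hK, fun a ha => hm.trans (sum_le_sum (h.le K hK a ha))⟩

theorem ExponentSystem.IsMonomial.blowUp [DecidableEq I] (h : X.IsMonomial m ω) {J : Finset I}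
    (hJ : J ∈ X.Sing m) : (X.blowUp m J).IsMonomial m (transformExp m J ω) where
  le := by
    rintro K' hK' _ ⟨a, ha, rfl⟩
    exact transformExp_mono (h.le _ (SupportFabric.mem_blowUp.1 hK').1 a ha)
  attained := by
    intro K' hK'
    obtain ⟨a, ha, haω⟩ := h.attained _ (below_mem_sing hJ hK')
    exact ⟨_, ⟨a, ha, rfl⟩, transformExp_mono haω⟩

/-- The multiset of the orders of `ω` along all strata. -/
noncomputable def SupportFabric.orders [Finite I] (F : SupportFabric I) (ω : I → ℕ) : Multiset ℕ :=
  F.strata.toFinite.toFinset.val.map fun K => ∑ k ∈ K, ω k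

/-- Strata not containing `J` keep their order. A new stratum over `K ⊇ J` loses some `j ∈ J` and
gains `∑ i ∈ J, ω i - m`, which is less than `ω j` by `hmin`, so its order is below that of `K`. -/
theorem SupportFabric.orders_blowUp_lt [Finite I] [DecidableEq I] {F : SupportFabric I} {ω : I → ℕ}
    {J : Finset I} (hJF : J ∈ F.strata) (hJ : m ≤ ∑ j ∈ J, ω j)
    (hmin : ∀ j ∈ J, ∑ i ∈ J.erase j, ω i < m) :
    ((F.blowUp J).orders (transformExp m J ω)).IsDershowitzMannaLT (F.orders ω) := by
  classical
  set S := F.strata.toFinite.toFinset with hS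
  set S' := (F.blowUp J).strata.toFinite.toFinset with hS'
  have mS : ∀ K, K ∈ S ↔ K ∈ F.strata := fun K => Set.Finite.mem_toFinset _
  have mS' : ∀ K, K ∈ S' ↔ K ∈ (F.blowUp J).strata := fun K => Set.Finite.mem_toFinset _
  -- The three multisets are the common part, the added part (strata through `∞`) and the removed
  -- part (strata containing `J`).
  refine ⟨(S.filter (¬ J ⊆ ·)).val.map fun K => ∑ k ∈ K, ω k,
    (S'.filter (none ∈ ·)).val.map fun K => ∑ k ∈ K, transformExp m J ω k,
    (S.filter (J ⊆ ·)).val.map fun K => ∑ k ∈ K, ω k, ?_, ?_, ?_, ?_⟩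
  · intro h0
    have h1 : S.filter (J ⊆ ·) = ∅ := val_eq_zero.1 (Multiset.map_eq_zero.1 h0)
    exact ne_empty_of_mem (mem_filter.2 ⟨(mS J).2 hJF, Subset.refl J⟩) h1
  · have e : S'.filter (¬ none ∈ ·) =
        (S.filter (¬ J ⊆ ·)).map (mapEmbedding Function.Embedding.some).toEmbedding := by
      ext K'
      simp only [mem_filter, mem_map, mS, mS', SupportFabric.mem_blowUp]
      constructor
      · rintro ⟨⟨h1, h2⟩, h3⟩
        rw [below_of_notMem h3] at h1
        refine ⟨_, ⟨h1, h2⟩, ?_⟩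
        exact (map_some_eraseNone K').trans (erase_eq_of_notMem h3)
      · rintro ⟨K, ⟨h1, h2⟩, rfl⟩
        have hn : none ∉ K.map Function.Embedding.some := by simp
        have he : below J (K.map Function.Embedding.some) = K := by simp [below_of_notMem hn]
        refine ⟨⟨?_, ?_⟩, hn⟩
        · exact he.symm ▸ h1
        · exact (eraseNone_map_some K).symm ▸ h2
    have e2 : (S.filter (¬ J ⊆ ·)).val.map (fun K => ∑ k ∈ K, ω k) =
        (S'.filter (¬ none ∈ ·)).val.map fun K => ∑ k ∈ K, transformExp m J ω k := by
      rw [e, map_val, Multiset.map_map]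
      refine Multiset.map_congr rfl fun K _ => ?_
      exact (sum_map K Function.Embedding.some (transformExp m J ω)).symm
    rw [e2, ← Multiset.map_add, filter_val, filter_val, add_comm, Multiset.filter_add_not]
    rfl
  · rw [← Multiset.map_add, filter_val, filter_val, add_comm, Multiset.filter_add_not]
    rfl
  · intro y hy
    obtain ⟨K', hK', rfl⟩ := Multiset.mem_map.1 hy
    obtain ⟨hK'S, hn⟩ := mem_filter (p := (none ∈ ·)).1 hK'
    obtain ⟨hK, hJK'⟩ := SupportFabric.mem_blowUp.1 ((mS' K').1 hK'S)
    refine ⟨_, Multiset.mem_map.2 ⟨below J K', mem_filter (p := (J ⊆ ·)).2 ⟨(mS _).2 hK,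
      subset_below hn⟩, rfl⟩, ?_⟩
    obtain ⟨j, hj, hjK'⟩ := not_subset.1 hJK'
    have hjK := subset_below hn hj
    have h1 : ∑ i ∈ K'.eraseNone, ω i ≤ ∑ i ∈ (below J K').erase j, ω i :=
      sum_le_sum_of_subset fun i hi =>
        mem_erase.2 ⟨fun e => hjK' (e ▸ hi), eraseNone_subset_below hi⟩
    have h2 := add_sum_erase (below J K') ω hjK
    have h3 := add_sum_erase J ω hj
    have h4 := hmin j hj
    rw [sum_of_none_mem hn]
    simp only [transformExp_none, transformExp_some]
    omega

end Monomial

/-- Blowing up an inclusion-minimal singular stratum lowers the orders in the well-founded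
Dershowitz–Manna ordering: minimality gives order less than `m` as soon as one index is removed from
the centre. -/
theorem ExponentSystem.IsMonomial.resolvable {m : ℕ} {I : Type u} [Finite I] [DecidableEq I]
    {X : ExponentSystem I} {ω : I → ℕ} (h : X.IsMonomial m ω) : Resolvable m X := by
  suffices H : ∀ M : Multiset ℕ, ∀ {I : Type u} [Finite I] [DecidableEq I] {X : ExponentSystem I}
      {ω : I → ℕ}, X.IsMonomial m ω → X.fabric.orders ω = M → Resolvable m X from H _ h rfl
  refine Multiset.wellFounded_isDershowitzMannaLT.fix ?_
  rintro _ ih I _ _ X ω h rfl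
  rcases (X.Sing m).eq_empty_or_nonempty with h0 | hne
  · exact .of_sing_eq_empty X h0
  obtain ⟨J, hJ⟩ := (X.Sing m).toFinite.exists_minimal hne
  refine .of_blowUp X J hJ.1 (ih _ ?_ (h.blowUp hJ.1) rfl)
  refine SupportFabric.orders_blowUp_lt hJ.1.1 ((h.mem_sing_iff hJ.1.1).1 hJ.1) fun j hj => ?_
  have hs := erase_subset j J
  by_contra! hlt
  exact notMem_erase j J
    (hJ.2 ((h.mem_sing_iff (X.fabric.mem_of_subset hs hJ.1.1)).2 hlt) hs hj)

/-! ### Maximal contact -/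

/-- The hypersurface `i` has maximal contact with `X` along `K`: it occurs in the initial form of
order at most `m`. -/
def ExponentSystem.HasContact {I : Type u} (m : ℕ) (X : ExponentSystem I) (i : I) (K : Finset I) :
    Prop :=
  i ∈ K ∧ ∃ a ∈ X.exps K, ∑ k ∈ K, a k ≤ m ∧ 0 < a i

/-- Along each singular stratum, some hypersurface of `B` has maximal contact with `X`. -/
def ExponentSystem.IsCovered {I : Type u} (m : ℕ) (X : ExponentSystem I) (B : Finset I) : Prop :=
  ∀ K ∈ X.Sing m, ∃ i ∈ B, X.HasContact m i K

section Contact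

variable {I : Type u} [DecidableEq I] {m : ℕ} {X : ExponentSystem I} {J : Finset I}

/-- The contact exponent has order at most `m` below, and its transform has order at least `m`
because `K'` is singular. All intermediate inequalities are then equalities, so the exponent
vanishes off `K'`; as it is positive at `i`, the stratum `K'` contains `some i`. -/
theorem ExponentSystem.HasContact.blowUp {i : I} {K' : Finset (Option I)} (hJ : J ∈ X.Sing m)
    (hK' : K' ∈ (X.blowUp m J).Sing m) (h : X.HasContact m i (below J K')) :
    (X.blowUp m J).HasContact m (some i) K' := by
  obtain ⟨hi, a, ha, ham, hai⟩ := h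
  have hK := (SupportFabric.mem_blowUp.1 hK'.1).1
  have h1 : ∑ k ∈ K', transformExp m J a k ≤ ∑ i ∈ K'.eraseNone, a i :=
    sum_transformExp_le (fun hn => le_sum_of_subset hJ (subset_below hn) hK a ha) ham
  have h2 := hK'.2 _ ⟨a, ha, rfl⟩
  have h3 : ∑ i ∈ K'.eraseNone, a i ≤ ∑ k ∈ below J K', a k :=
    sum_le_sum_of_subset eraseNone_subset_below
  have h4 := (sum_eq_and_eq_zero_of_le eraseNone_subset_below (h2.trans h1) ham).2 i hi
  refine ⟨?_, _, ⟨a, ha, rfl⟩, by omega, hai⟩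
  by_contra hiK
  exact hai.ne' (h4 fun hi' => hiK (mem_eraseNone.1 hi'))

theorem ExponentSystem.IsCovered.blowUp {B : Finset I} (h : X.IsCovered m B) (hJ : J ∈ X.Sing m) :
    (X.blowUp m J).IsCovered m (B.map Function.Embedding.some) := by
  intro K' hK'
  obtain ⟨i, hi, hc⟩ := h _ (below_mem_sing hJ hK')
  exact ⟨some i, mem_map_of_mem _ hi, hc.blowUp hJ hK'⟩

/-- The blow-up of a singular hypersurface removes it from a covering by maximal contact. -/
theorem ExponentSystem.IsCovered.blowUp_singleton {B : Finset I} {i : I}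
    (h : X.IsCovered m (insert i B)) (hi : {i} ∈ X.Sing m) :
    (X.blowUp m {i}).IsCovered m (B.map Function.Embedding.some) := by
  intro K' hK'
  obtain ⟨j, hj, hc⟩ := h _ (below_mem_sing hi hK')
  have hc' := hc.blowUp hi hK'
  rcases mem_insert.1 hj with rfl | hj
  -- No stratum of the blow-up contains the centre, so `i` itself is never the contact index
  -- upstairs.
  · exact absurd (singleton_subset_iff.2 (mem_eraseNone.2 hc'.1))
      (SupportFabric.mem_blowUp.1 hK'.1).2
  · exact ⟨some j, mem_map_of_mem _ hj, hc'⟩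

end Contact

/-! ### Coefficient systems -/

/-- The exponent obtained from `a` by projection from the coordinate `i`, scaled to the
denominator `m!`. -/
def coeffExp {I : Type u} (m : ℕ) (i : I) (a : I → ℕ) : I → ℕ := fun j =>
  m.factorial / (m - a i) * a j

section CoeffExp

variable {I : Type u} {m : ℕ} {i : I}

theorem factorial_div_mul_sub {n : ℕ} (h : n < m) :
    m.factorial / (m - n) * (m - n) = m.factorial :=
  Nat.div_mul_cancel (Nat.dvd_factorial (Nat.sub_pos_of_lt h) (Nat.sub_le m n))

theorem coeffExp_mono {a b : I → ℕ} {L : Finset I} (hi : b i ≤ a i) (ha : a i < m)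
    (h : ∀ j ∈ L, b j ≤ a j) : ∀ j ∈ L, coeffExp m i b j ≤ coeffExp m i a j := fun j hj =>
  Nat.mul_le_mul (Nat.div_le_div_left (Nat.sub_le_sub_left hi m) (Nat.sub_pos_of_lt ha)) (h j hj)

/-- The inequality `m - a i ≤ ∑ j ∈ L, a j` is multiplied by the integer `m! / (m - a i)`; the
denominator `m!` serves all values of `a i` at once. -/
theorem factorial_le_sum_coeffExp [DecidableEq I] {a : I → ℕ} {L : Finset I} (hi : i ∉ L)
    (ha : a i < m) :
    m.factorial ≤ ∑ j ∈ L, coeffExp m i a j ↔ m ≤ ∑ j ∈ insert i L, a j := by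
  have hc := factorial_div_mul_sub ha
  have hpos : 0 < m.factorial / (m - a i) :=
    Nat.pos_of_mul_pos_right (hc ▸ m.factorial_pos)
  have hs : ∑ j ∈ L, coeffExp m i a j = m.factorial / (m - a i) * ∑ j ∈ L, a j :=
    (mul_sum L a _).symm
  rw [sum_insert hi, hs]
  conv_lhs => lhs; rw [← hc]
  rw [Nat.mul_le_mul_left_iff hpos]
  omega

/-- Projection commutes with blow-up because `(a i + ∑ j ∈ J, a j) - m = ∑ j ∈ J, a j - (m - a i)`,
and the scaling factor depends only on `a i`, which the blow-up leaves alone. -/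
theorem transformExp_coeffExp [DecidableEq I] {a : I → ℕ} {J : Finset I} (hi : i ∉ J)
    (ha : a i < m) : transformExp m.factorial J (coeffExp m i a) =
      coeffExp m (some i) (transformExp m (insert i J) a) := by
  funext k
  rcases k with _ | j
  · have hc := factorial_div_mul_sub ha
    have hs : ∑ j ∈ J, coeffExp m i a j = m.factorial / (m - a i) * ∑ j ∈ J, a j :=
      (mul_sum J a _).symm
    simp only [transformExp_none, coeffExp, transformExp_some, sum_insert hi]
    change ∑ j ∈ J, coeffExp m i a j - _ = _
    rw [hs]
    conv_lhs => rhs; rw [← hc]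
    rw [← Nat.mul_sub]
    congr 1
    omega
  · rfl

end CoeffExp

section Coeff

variable {I : Type u} [DecidableEq I] {m : ℕ} {i : I}

/-- The coefficient system of `X` on the link of the non-singular hypersurface `i`. -/
def ExponentSystem.coeff (m : ℕ) (X : ExponentSystem I) (i : I) (hi : {i} ∉ X.Sing m) :
    ExponentSystem I where
  fabric :=
    { strata := {L | i ∉ L ∧ insert i L ∈ X.fabric.strata}
      mem_of_subset := fun _ _ h h₂ =>
        ⟨fun h₁ => h₂.1 (h h₁), X.fabric.mem_of_subset (insert_subset_insert i h) h₂.2⟩ }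
  exps L := coeffExp m i '' {a | a ∈ X.exps (insert i L) ∧ a i < m}
  nonempty L hL := by
    have hs : {i} ⊆ insert i L := singleton_subset_iff.2 (mem_insert_self i L)
    -- This is where non-singularity of `{i}` enters: it provides an exponent that survives
    -- projection, and `extend` carries it to larger strata.
    have h1 : ∃ a ∈ X.exps {i}, a i < m := by
      by_contra! h
      exact hi ⟨X.fabric.mem_of_subset hs hL.2, by simpa using h⟩
    obtain ⟨a, ha, hai⟩ := h1
    obtain ⟨b, hb, hba⟩ := X.extend hs hL.2 a ha
    exact ⟨_, b, ⟨hb, (hba i (mem_singleton_self i)).trans_lt hai⟩, rfl⟩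
  restrict L M hLM hM := by
    rintro _ ⟨a, ⟨ha, hai⟩, rfl⟩
    obtain ⟨b, hb, hba⟩ := X.restrict (insert_subset_insert i hLM) hM.2 a ha
    have hbi := hba i (mem_insert_self i L)
    exact ⟨_, ⟨b, ⟨hb, hbi.trans_lt hai⟩, rfl⟩,
      coeffExp_mono hbi hai fun j hj => hba j (mem_insert_of_mem hj)⟩
  extend L M hLM hM := by
    rintro _ ⟨a, ⟨ha, hai⟩, rfl⟩
    obtain ⟨b, hb, hba⟩ := X.extend (insert_subset_insert i hLM) hM.2 a ha
    have hbi := hba i (mem_insert_self i L)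
    exact ⟨_, ⟨b, ⟨hb, hbi.trans_lt hai⟩, rfl⟩,
      coeffExp_mono hbi hai fun j hj => hba j (mem_insert_of_mem hj)⟩

/-- `X` is the coefficient system of `Y` on the link of `i`. -/
structure IsCoeff (m : ℕ) (i : I) (X Y : ExponentSystem I) : Prop where
  mem_iff : ∀ L, L ∈ X.fabric.strata ↔ i ∉ L ∧ insert i L ∈ Y.fabric.strata
  exps_eq : ∀ L ∈ X.fabric.strata,
    X.exps L = coeffExp m i '' {a | a ∈ Y.exps (insert i L) ∧ a i < m}

variable {X Y : ExponentSystem I}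

theorem IsCoeff.mem_sing_iff (h : IsCoeff m i X Y) (L : Finset I) :
    L ∈ X.Sing m.factorial ↔ i ∉ L ∧ insert i L ∈ Y.Sing m := by
  constructor
  · rintro ⟨hL, hs⟩
    obtain ⟨hi, hL'⟩ := (h.mem_iff L).1 hL
    refine ⟨hi, hL', fun a ha => ?_⟩
    rcases lt_or_ge (a i) m with hai | hai
    · refine (factorial_le_sum_coeffExp hi hai).1 (hs _ ?_)
      rw [h.exps_eq L hL]
      exact ⟨a, ⟨ha, hai⟩, rfl⟩
    -- The exponents discarded from the coefficient system have order at least `m` from the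
    -- coordinate `i` alone, so they impose no condition.
    · rw [sum_insert hi]; omega
  · rintro ⟨hi, hL', hs⟩
    have hL := (h.mem_iff L).2 ⟨hi, hL'⟩
    refine ⟨hL, ?_⟩
    rw [h.exps_eq L hL]
    rintro _ ⟨a, ⟨ha, hai⟩, rfl⟩
    exact (factorial_le_sum_coeffExp hi hai).2 (hs a ha)

theorem below_insert_some (i : I) (J : Finset I) (L' : Finset (Option I)) :
    below (insert i J) (insert (some i) L') = insert i (below J L') := by
  ext j
  simp only [mem_below, mem_insert, Option.some.injEq, reduceCtorEq, false_or]
  tauto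

/-- This compatibility lets a resolution of the coefficient system be lifted centre by centre, with
`J` replaced by `insert i J`. -/
theorem IsCoeff.blowUp (h : IsCoeff m i X Y) {J : Finset I} (hJ : J ∈ X.Sing m.factorial) :
    IsCoeff m (some i) (X.blowUp m.factorial J) (Y.blowUp m (insert i J)) := by
  have hiJ := ((h.mem_sing_iff J).1 hJ).1
  have e (L' : Finset (Option I)) : insert i J ⊆ (insert (some i) L').eraseNone ↔
      J ⊆ L'.eraseNone := by
    simp only [subset_iff, mem_insert, mem_eraseNone, Option.some.injEq, forall_eq_or_imp,
      true_or, true_and]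
    exact forall₂_congr fun j hj => or_iff_right fun e => hiJ (e ▸ hj)
  have hb (L' : Finset (Option I)) : i ∉ below J L' ↔ some i ∉ L' := by
    rw [mem_below]; tauto
  constructor
  · intro L'
    change L' ∈ (X.fabric.blowUp J).strata ↔
      _ ∧ insert (some i) L' ∈ (Y.fabric.blowUp (insert i J)).strata
    rw [SupportFabric.mem_blowUp, SupportFabric.mem_blowUp, h.mem_iff, hb, e, below_insert_some,
      and_assoc]
  · intro L' hL'
    change transformExp _ J '' X.exps (below J L') = coeffExp m (some i) ''
      {a | a ∈ transformExp m (insert i J) '' Y.exps (below (insert i J) (insert (some i) L')) ∧ _}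
    rw [h.exps_eq _ (SupportFabric.mem_blowUp.1 hL').1, below_insert_some]
    ext f
    constructor
    · rintro ⟨_, ⟨a, ⟨ha, hai⟩, rfl⟩, rfl⟩
      exact ⟨_, ⟨⟨a, ha, rfl⟩, hai⟩, (transformExp_coeffExp hiJ hai).symm⟩
    · rintro ⟨_, ⟨⟨a, ha, rfl⟩, hai⟩, rfl⟩
      exact ⟨_, ⟨a, ⟨ha, hai⟩, rfl⟩, transformExp_coeffExp hiJ hai⟩

end Coeff

/-! ### Resolution by maximal contact, assuming smaller strata can be resolved. -/

/-- All exponent systems with strata of at most `n` elements are resolvable. -/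
def ResolvableUpTo (n : ℕ) : Prop :=
  ∀ {I : Type u} [Finite I] [DecidableEq I] (X : ExponentSystem I) (m : ℕ), 0 < m →
    (∀ K ∈ X.fabric.strata, K.card ≤ n) → Resolvable m X

theorem card_le_of_mem_blowUp {I : Type u} [DecidableEq I] {F : SupportFabric I} {n : ℕ}
    (h : ∀ K ∈ F.strata, K.card ≤ n) (J : Finset I) : ∀ K' ∈ (F.blowUp J).strata, K'.card ≤ n :=
  fun _ hK' =>
    have := SupportFabric.mem_blowUp.1 hK'
    (card_le_card_below this.2).trans (h _ this.1)

/-- Induction on the number of contact indices. A chosen `i` is discarded by blowing up `{i}` if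
that is singular, and otherwise by lifting a resolution of its coefficient system, whose strata are
smaller by one element. -/
theorem ExponentSystem.IsCovered.resolvable {n m : ℕ} (ih : ResolvableUpTo.{u} n) {c : ℕ} :
    ∀ {I : Type u} [Finite I] [DecidableEq I] {X : ExponentSystem I} {B : Finset I},
      (∀ K ∈ X.fabric.strata, K.card ≤ n + 1) → B.card = c → X.IsCovered m B →
        Resolvable m X := by
  induction c with
  | zero =>
    intro I _ _ X B _ hB h
    rw [card_eq_zero.1 hB] at h
    refine .of_sing_eq_empty X (Set.eq_empty_iff_forall_notMem.2 fun K hK => ?_)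
    simpa using h K hK
  | succ c ihc =>
    intro I _ _ X B hn hB h
    obtain ⟨i, B, hiB, rfl, hc⟩ := card_eq_succ.1 hB
    by_cases hi : {i} ∈ X.Sing m
    · exact .of_blowUp X {i} hi (ihc (card_le_of_mem_blowUp hn _) (by rw [card_map, hc])
        (h.blowUp_singleton hi))
    refine Resolvable.lift (m := m.factorial)
      (fun {I} _ X Y => Finite I ∧ (∀ K ∈ Y.fabric.strata, K.card ≤ n + 1) ∧
        ∃ i B, B.card = c ∧ Y.IsCovered m (insert i B) ∧ IsCoeff m i X Y) ?_ ?_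
      (ih (X.coeff m i hi) m.factorial m.factorial_pos ?_)
      ⟨inferInstance, hn, i, B, hc, h, fun _ => Iff.rfl, fun _ _ => rfl⟩
    · rintro I _ X Y J ⟨_, hn, i, B, hc, h, hXY⟩ hJ
      have hJ' := ((hXY.mem_sing_iff J).1 hJ).2
      refine ⟨_, hJ', inferInstance, card_le_of_mem_blowUp hn _, some i,
        B.map Function.Embedding.some, by rw [card_map, hc], ?_, hXY.blowUp hJ⟩
      convert h.blowUp hJ' using 1
      exact (map_insert Function.Embedding.some i B).symm
    · rintro I _ X Y ⟨_, hn, i, B, hc, h, hXY⟩ h0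
      refine ihc hn hc fun K hK => ?_
      obtain ⟨j, hj, hjK⟩ := h K hK
      rcases mem_insert.1 hj with rfl | hj
      -- A singular stratum containing `j` would leave a singular stratum in the resolved
      -- coefficient system, so the remaining indices already cover.
      · have : K.erase j ∈ X.Sing m.factorial :=
          (hXY.mem_sing_iff _).2 ⟨notMem_erase j K, (insert_erase hjK.1).symm ▸ hK⟩
        simp [h0] at this
      · exact ⟨j, hj, hjK⟩
    · intro L hL
      have := hn _ hL.2
      rw [card_insert_of_notMem hL.1] at this
      omega

/-- Systems of order at most `m` along their singular strata are resolvable. -/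
theorem ResolvableUpTo.of_sum_le {n m : ℕ} (ih : ResolvableUpTo.{u} n) (hm : 0 < m) {I : Type u}
    [Finite I] [DecidableEq I] {X : ExponentSystem I}
    (hn : ∀ K ∈ X.fabric.strata, K.card ≤ n + 1)
    (h : ∀ K ∈ X.Sing m, ∃ a ∈ X.exps K, ∑ k ∈ K, a k ≤ m) : Resolvable m X := by
  have := Fintype.ofFinite I
  refine ExponentSystem.IsCovered.resolvable ih (B := univ) hn rfl fun K hK => ?_
  obtain ⟨a, ha, ham⟩ := h K hK
  obtain ⟨i, hi, hai⟩ : ∃ i ∈ K, a i ≠ 0 := exists_ne_zero_of_sum_ne_zero (by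
    have := hK.2 a ha
    omega)
  exact ⟨i, mem_univ i, hi, a, ha, ham, Nat.pos_of_ne_zero hai⟩

/-! ### Companion systems -/

section Agrees

variable {I : Type u} {K : Finset I} {A B C : Set (I → ℕ)}

/-- `A` and `B` dominate each other on the coordinates in `K`. -/
def Agrees (K : Finset I) (A B : Set (I → ℕ)) : Prop := Dominates K A B ∧ Dominates K B A

theorem Agrees.trans (h : Agrees K A B) (h' : Agrees K B C) : Agrees K A C :=
  ⟨h.1.trans h'.1, h'.2.trans h.2⟩

theorem Agrees.union {A' B' : Set (I → ℕ)} (h : Agrees K A B) (h' : Agrees K A' B') :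
    Agrees K (A ∪ A') (B ∪ B') :=
  ⟨h.1.union h'.1, h.2.union h'.2⟩

theorem agrees_image {κ : Type u} {f g : (I → ℕ) → κ → ℕ} {M : Finset κ}
    (hfg : ∀ a ∈ A, ∀ j ∈ M, f a j = g a j) : Agrees M (f '' A) (g '' A) :=
  ⟨dominates_image fun a ha j hj => (hfg a ha j hj).ge,
    dominates_image fun a ha j hj => (hfg a ha j hj).le⟩

theorem Agrees.transform [DecidableEq I] {m : ℕ} {J : Finset I} {J' : Finset (Option I)}
    (h : Agrees (below J J') A B) :
    Agrees J' (transformExp m J '' A) (transformExp m J '' B) :=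
  ⟨h.1.transform, h.2.transform⟩

theorem Agrees.le_sum_iff (h : Agrees K A B) (m : ℕ) :
    (∀ a ∈ A, m ≤ ∑ k ∈ K, a k) ↔ ∀ b ∈ B, m ≤ ∑ k ∈ K, b k :=
  ⟨h.2.le_sum, h.1.le_sum⟩

end Agrees

/-- Multiplication of an exponent by the monomial `ω`. -/
def shiftExp {I : Type u} (ω a : I → ℕ) : I → ℕ := fun i => ω i + a i

/-- The `n`-th power of an exponent. -/
def scaleExp {I : Type u} (n : ℕ) (a : I → ℕ) : I → ℕ := fun i => n * a i

/-- The monomial part of the transform with denominator `m` if the remaining part is transformed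
with denominator `r`. -/
def transformMonomial {I : Type u} (m r : ℕ) (J : Finset I) (ω : I → ℕ) : Option I → ℕ
  | none => ∑ j ∈ J, ω j + r - m
  | some i => ω i

/-- `Y` is the product of the monomial `ω` and the system `N`. -/
structure IsShift {I : Type u} (ω : I → ℕ) (N Y : ExponentSystem I) : Prop where
  fabric_eq : Y.fabric = N.fabric
  agrees : ∀ K ∈ N.fabric.strata, Agrees K (Y.exps K) (shiftExp ω '' N.exps K)

/-- `X` has the exponents of the `m`-th power of `N` and of the `r`-th power of its product with
the monomial `ω`. -/
structure IsCompanion {I : Type u} (m r : ℕ) (ω : I → ℕ) (N X : ExponentSystem I) : Prop where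
  fabric_eq : X.fabric = N.fabric
  agrees : ∀ K ∈ N.fabric.strata, Agrees K (X.exps K)
    (scaleExp m '' N.exps K ∪ (fun a => scaleExp r (shiftExp ω a)) '' N.exps K)

/-- The companion system of the product of the monomial `ω` and the system `N`. -/
def ExponentSystem.companion {I : Type u} (m r : ℕ) (ω : I → ℕ) (N : ExponentSystem I) :
    ExponentSystem I where
  fabric := N.fabric
  exps K := scaleExp m '' N.exps K ∪ (fun a => scaleExp r (shiftExp ω a)) '' N.exps K
  nonempty K hK := ((N.nonempty K hK).image _).inl
  restrict _ _ h hK := ((N.restrict h hK).image_image fun _ _ _ _ hab j hj =>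
    Nat.mul_le_mul_left _ (hab j hj)).union ((N.restrict h hK).image_image fun _ _ _ _ hab j hj =>
    Nat.mul_le_mul_left _ (Nat.add_le_add_left (hab j hj) _))
  extend _ _ h hK := ((N.extend h hK).image_image fun _ _ _ _ hab j hj =>
    Nat.mul_le_mul_left _ (hab j hj)).union ((N.extend h hK).image_image fun _ _ _ _ hab j hj =>
    Nat.mul_le_mul_left _ (Nat.add_le_add_left (hab j hj) _))

section Companion

variable {I : Type u} {m r : ℕ} {ω : I → ℕ} {N X Y : ExponentSystem I} {J K : Finset I}

theorem sum_scaleExp (n : ℕ) (a : I → ℕ) (K : Finset I) :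
    ∑ k ∈ K, scaleExp n a k = n * ∑ k ∈ K, a k :=
  (mul_sum K a n).symm

theorem sum_shiftExp (ω a : I → ℕ) (K : Finset I) :
    ∑ k ∈ K, shiftExp ω a k = ∑ k ∈ K, ω k + ∑ k ∈ K, a k :=
  sum_add_distrib

theorem transformExp_scaleExp (n : ℕ) (a : I → ℕ) :
    transformExp (n * m) J (scaleExp n a) = scaleExp n (transformExp m J a) := by
  funext k
  rcases k with _ | i
  · rw [transformExp_none, sum_scaleExp, ← Nat.mul_sub]; rfl
  · rfl

/-- The exceptional order `∑ ω + ∑ a - m` splits as `(∑ ω + r - m) + (∑ a - r)`; the two hypotheses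
make both truncated differences exact. -/
theorem transformExp_shiftExp {a : I → ℕ} {J' : Finset (Option I)}
    (hm : m ≤ ∑ j ∈ J, ω j + r) (ha : none ∈ J' → r ≤ ∑ j ∈ J, a j) :
    ∀ k ∈ J', transformExp m J (shiftExp ω a) k =
      shiftExp (transformMonomial m r J ω) (transformExp r J a) k := by
  rintro (_ | i) hk
  · have := ha hk
    rw [transformExp_none, sum_shiftExp]
    simp only [shiftExp, transformMonomial, transformExp_none]
    omega
  · rfl

theorem IsShift.mem_sing_iff (h : IsShift ω N Y) :
    K ∈ Y.Sing m ↔ K ∈ N.fabric.strata ∧ ∀ a ∈ N.exps K, m ≤ ∑ k ∈ K, ω k + ∑ k ∈ K, a k := by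
  change K ∈ Y.fabric.strata ∧ _ ↔ _
  rw [h.fabric_eq]
  refine and_congr_right fun hK => ?_
  simp [(h.agrees K hK).le_sum_iff, sum_shiftExp]

/-- For the denominator `m * r`, the exponents `m * a` test whether `N` has order at least `r`, and
the exponents `r * (ω + a)` test whether `Y` has order at least `m`. -/
theorem IsCompanion.mem_sing_iff (h : IsCompanion m r ω N X) (hY : IsShift ω N Y) (hm : 0 < m)
    (hr : 0 < r) : K ∈ X.Sing (m * r) ↔ K ∈ N.Sing r ∧ K ∈ Y.Sing m := by
  rw [hY.mem_sing_iff]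
  change K ∈ X.fabric.strata ∧ _ ↔ (K ∈ N.fabric.strata ∧ _) ∧ _
  rw [h.fabric_eq, and_assoc]
  refine and_congr_right fun hK => ?_
  simp only [(h.agrees K hK).le_sum_iff, Set.mem_union, or_imp, forall_and, Set.forall_mem_image,
    sum_scaleExp, sum_shiftExp, hK, true_and]
  refine and_congr (forall₂_congr fun a _ => Nat.mul_le_mul_left_iff hm)
    (forall₂_congr fun a _ => ?_)
  rw [mul_comm m r]
  exact Nat.mul_le_mul_left_iff hr

variable [DecidableEq I]

theorem IsShift.blowUp (h : IsShift ω N Y) (hJ : J ∈ N.Sing r) (hm : m ≤ ∑ j ∈ J, ω j + r) :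
    IsShift (transformMonomial m r J ω) (N.blowUp r J) (Y.blowUp m J) where
  fabric_eq := congrArg (·.blowUp J) h.fabric_eq
  agrees K' hK' := by
    have hK := (SupportFabric.mem_blowUp.1 hK').1
    refine (h.agrees _ hK).transform.trans ?_
    change Agrees K' _ (_ '' (_ '' _))
    rw [Set.image_image, Set.image_image]
    exact agrees_image fun a ha => transformExp_shiftExp hm fun hn =>
      ExponentSystem.le_sum_of_subset hJ (subset_below hn) hK a ha

theorem IsCompanion.blowUp (h : IsCompanion m r ω N X) (hJ : J ∈ N.Sing r)
    (hm : m ≤ ∑ j ∈ J, ω j + r) :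
    IsCompanion m r (transformMonomial m r J ω) (N.blowUp r J) (X.blowUp (m * r) J) where
  fabric_eq := congrArg (·.blowUp J) h.fabric_eq
  agrees K' hK' := by
    have hK := (SupportFabric.mem_blowUp.1 hK').1
    refine (h.agrees _ hK).transform.trans ?_
    change Agrees K' _ (_ '' (_ '' _) ∪ _ '' (_ '' _))
    rw [Set.image_union, Set.image_image, Set.image_image, Set.image_image, Set.image_image]
    refine Agrees.union ?_ ?_
    · exact agrees_image fun a _ j _ => congrFun (transformExp_scaleExp m a) j
    · refine agrees_image fun a ha j hj => ?_
      rw [mul_comm m r, transformExp_scaleExp]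
      exact congrArg (r * ·) (transformExp_shiftExp hm (fun hn =>
        ExponentSystem.le_sum_of_subset hJ (subset_below hn) hK a ha) j hj)

/-- Under a blow-up which is permissible for `N`, the order of `N` along singular strata of `Y`
does not increase. -/
theorem IsShift.exists_sum_le_blowUp (hY : IsShift ω N Y) (hJN : J ∈ N.Sing r) (hJ : J ∈ Y.Sing m)
    (h : ∀ K ∈ Y.Sing m, ∃ a ∈ N.exps K, ∑ k ∈ K, a k ≤ r) :
    ∀ K' ∈ (Y.blowUp m J).Sing m, ∃ a ∈ (N.blowUp r J).exps K', ∑ k ∈ K', a k ≤ r := by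
  intro K' hK'
  have hKS := ExponentSystem.below_mem_sing hJ hK'
  obtain ⟨a, ha, har⟩ := h _ hKS
  have hK : below J K' ∈ N.fabric.strata := hY.fabric_eq ▸ hKS.1
  refine ⟨_, ⟨a, ha, rfl⟩, (sum_transformExp_le (fun hn =>
    ExponentSystem.le_sum_of_subset hJN (subset_below hn) hK a ha) har).trans ?_⟩
  exact (sum_le_sum_of_subset eraseNone_subset_below).trans har

end Companion

/-- Induction on the bound `r` for the order of `N` along the singular strata of `Y`. At `r = 0` the
system is monomial. For a positive bound, the centres resolving the companion also serve for `Y`;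
once the companion is non-singular, the bound has dropped by one. -/
theorem IsShift.resolvable {n m : ℕ} (ih : ResolvableUpTo.{u} n) (hm : 0 < m) {r : ℕ} :
    ∀ {I : Type u} [Finite I] [DecidableEq I] {ω : I → ℕ} {N Y : ExponentSystem I},
      (∀ K ∈ Y.fabric.strata, K.card ≤ n + 1) → IsShift ω N Y →
        (∀ K ∈ Y.Sing m, ∃ a ∈ N.exps K, ∑ k ∈ K, a k ≤ r) → Resolvable m Y := by
  induction r with
  | zero =>
    intro I _ _ ω N Y _ hY h
    refine ExponentSystem.IsMonomial.resolvable (ω := ω) ⟨fun K hK y hy k hk => ?_, fun K hK => ?_⟩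
    · obtain ⟨_, ⟨a, -, rfl⟩, hay⟩ := (hY.agrees K (hY.fabric_eq ▸ hK)).1 y hy
      exact (Nat.le_add_right _ _).trans (hay k hk)
    · obtain ⟨a, ha, ha0⟩ := h K hK
      obtain ⟨y, hy, hya⟩ := (hY.agrees K (hY.fabric_eq ▸ hK.1)).2 _ ⟨a, ha, rfl⟩
      refine ⟨y, hy, fun k hk => ?_⟩
      have : a k = 0 := sum_eq_zero_iff.1 (Nat.le_zero.1 ha0) k hk
      simpa [shiftExp, this] using hya k hk
  | succ r ihr =>
    intro I _ _ ω N Y hn hY h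
    have hr := r.succ_pos
    have hX : IsCompanion m (r + 1) ω N (N.companion m (r + 1) ω) :=
      ⟨rfl, fun K _ => ⟨.refl _ _, .refl _ _⟩⟩
    refine Resolvable.lift (m := m * (r + 1))
      (fun {I} _ X Y => Finite I ∧ (∀ K ∈ Y.fabric.strata, K.card ≤ n + 1) ∧
        ∃ ω N, IsCompanion m (r + 1) ω N X ∧ IsShift ω N Y ∧
          ∀ K ∈ Y.Sing m, ∃ a ∈ N.exps K, ∑ k ∈ K, a k ≤ r + 1) ?_ ?_
      (ih.of_sum_le (Nat.mul_pos hm hr) (X := N.companion m (r + 1) ω) (hY.fabric_eq ▸ hn) ?_)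
      ⟨inferInstance, hn, ω, N, hX, hY, h⟩
    · rintro I _ X Y J ⟨_, hn, ω, N, hX, hY, h⟩ hJ
      obtain ⟨hJN, hJY⟩ := (hX.mem_sing_iff hY hm hr).1 hJ
      obtain ⟨a, ha, har⟩ := h J hJY
      have hω : m ≤ ∑ j ∈ J, ω j + (r + 1) :=
        ((hY.mem_sing_iff.1 hJY).2 a ha).trans (Nat.add_le_add_left har _)
      exact ⟨J, hJY, inferInstance, card_le_of_mem_blowUp hn J, _, _, hX.blowUp hJN hω,
        hY.blowUp hJN hω, hY.exists_sum_le_blowUp hJN hJY h⟩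
    · rintro I _ X Y ⟨_, hn, ω, N, hX, hY, h⟩ h0
      refine ihr hn hY fun K hK => ?_
      by_contra! hc
      have : K ∈ X.Sing (m * (r + 1)) :=
        (hX.mem_sing_iff hY hm hr).2 ⟨⟨hY.fabric_eq ▸ hK.1, hc⟩, hK⟩
      simp [h0] at this
    · intro K hK
      obtain ⟨a, ha, har⟩ := h K ((hX.mem_sing_iff hY hm hr).1 hK).2
      -- The part `m * a` of the companion bounds its order by `m * (r + 1)`, its own denominator,
      -- as maximal contact requires.
      exact ⟨_, Or.inl ⟨a, ha, rfl⟩, by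
        rw [sum_scaleExp]; exact Nat.mul_le_mul_left m har⟩

theorem resolvableUpTo (n : ℕ) : ResolvableUpTo.{u} n := by
  induction n with
  | zero =>
    intro I _ _ X m hm hn
    refine .of_sing_eq_empty X (Set.eq_empty_iff_forall_notMem.2 fun K hK => ?_)
    obtain ⟨a, ha⟩ := X.nonempty K hK.1
    have := hK.2 a ha
    rw [card_eq_zero.1 (Nat.le_zero.1 (hn K hK.1)), sum_empty] at this
    omega
  | succ n ih =>
    intro I _ _ X m hm hn
    choose a ha using X.nonempty
    -- The trivial factorization `ω = 0`, `N = X` starts the descent; finitely many strata give a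
    -- common bound for the orders of the chosen exponents.
    obtain ⟨r, hr⟩ := (Set.finite_range fun K : X.fabric.strata =>
      ∑ k ∈ K.1, a K.1 K.2 k).bddAbove
    refine IsShift.resolvable ih hm (ω := 0) (N := X) (r := r) hn ⟨rfl, fun K _ => ?_⟩
      fun K hK => ⟨a K hK.1, ha K hK.1, hr ⟨⟨K, hK.1⟩, rfl⟩⟩
    have : shiftExp (0 : I → ℕ) = id := by
      funext a i; exact Nat.zero_add _
    rw [this, Set.image_id]
    exact ⟨.refl _ _, .refl _ _⟩

theorem ExponentSystem.resolvable {I : Type u} [Finite I] [DecidableEq I] (X : ExponentSystem I)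
    {m : ℕ} (hm : 0 < m) : Resolvable m X := by
  have := Fintype.ofFinite I
  exact resolvableUpTo (Fintype.card I) X m hm fun K _ => card_le_univ K

/-! ### Exponent systems as models of polyhedra systems -/

/-- The point of `ℝ^K` given by an exponent, for the denominator `d`. -/
noncomputable def expPoint {I : Type u} (d : ℕ) (K : Finset I) (a : I → ℕ) : K → ℝ := fun k =>
  (a k : ℝ) / d

/-- The polyhedra of `D` are generated by the exponents of `X`. -/
structure IsModel {I : Type u} (X : ExponentSystem I) (D : PolyhedraSystem I) : Prop where
  fabric_eq : X.fabric = D.fabric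
  Δ_eq : ∀ K ∈ D.fabric.strata, D.Δ K = posHull (expPoint D.d K '' X.exps K)

theorem sum_expPoint {I : Type u} (d : ℕ) (K : Finset I) (a : I → ℕ) :
    ∑ k, expPoint d K a k = ((∑ k ∈ K, a k : ℕ) : ℝ) / d := by
  rw [← sum_coe_sort K a, Nat.cast_sum, sum_div]
  rfl

theorem one_le_sum_expPoint {I : Type u} {d : ℕ} (hd : 0 < d) (K : Finset I) (a : I → ℕ) :
    1 ≤ ∑ k, expPoint d K a k ↔ d ≤ ∑ k ∈ K, a k := by
  rw [sum_expPoint, one_le_div (by exact_mod_cast hd), Nat.cast_le]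

theorem exists_expPoint_eq {I : Type u} [DecidableEq I] {d : ℕ} {K : Finset I} {σ : K → ℝ}
    (hσ : ∀ j, ∃ n : ℕ, σ j = (n : ℝ) / d) : ∃ a, expPoint d K a = σ := by
  choose n hn using hσ
  refine ⟨fun i => if h : i ∈ K then n ⟨i, h⟩ else 0, ?_⟩
  funext k
  simp [expPoint, hn]

theorem one_le_sum_of_mem_posHull {ι : Type*} [Fintype ι] {A : Set (ι → ℝ)}
    (hA : ∀ σ ∈ A, 1 ≤ ∑ j, σ j) : ∀ σ ∈ posHull A, 1 ≤ ∑ j, σ j := by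
  intro σ hσ
  have hc : Convex ℝ {τ : ι → ℝ | 1 ≤ ∑ j, τ j} :=
    convex_halfSpace_ge (f := fun τ : ι → ℝ => ∑ j, τ j)
      ⟨fun x y => by simp [sum_add_distrib], fun c x => by simp [mul_sum]⟩ _
  refine convexHull_min ?_ hc hσ
  rintro _ ⟨a, ha, t, ht, rfl⟩
  have h1 := hA a ha
  have h2 : 0 ≤ ∑ j, t j := sum_nonneg fun j _ => ht j
  simp only [Set.mem_ofPred_eq, Pi.add_apply, sum_add_distrib]
  linarith

theorem add_mem_posHull {ι : Type*} {A : Set (ι → ℝ)} {σ τ : ι → ℝ} (hσ : σ ∈ posHull A)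
    (hτ : ∀ j, 0 ≤ τ j) : σ + τ ∈ posHull A := by
  rw [← posHull_posHull]
  exact subset_convexHull ℝ _ ⟨σ, hσ, τ, hτ, rfl⟩

/-- The condition `1 ≤ ∑ j, σ j` is convex and stable under adding non-negative vectors, so it can
be tested on generators. -/
theorem IsModel.mem_sing_iff {I : Type u} {X : ExponentSystem I} {D : PolyhedraSystem I}
    (h : IsModel X D) {K : Finset I} : K ∈ X.Sing D.d ↔ K ∈ D.Sing := by
  constructor
  · rintro ⟨hK, hs⟩
    have hK' : K ∈ D.fabric.strata := h.fabric_eq ▸ hK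
    -- The convention `-1` for the empty stratum agrees with the model: its exponents have order
    -- `0`, less than `d`.
    have hne : K ≠ ∅ := by
      rintro rfl
      obtain ⟨a, ha⟩ := X.nonempty _ hK
      have := hs a ha
      rw [sum_empty] at this
      exact absurd D.d_pos (by omega)
    obtain ⟨σ, hσ, hδ⟩ := ((D.isCharPolyhedron K hK').isLeast_contactExponent D.d_pos
      (D.nonempty K hK') hne).1
    refine ⟨hK', hδ ▸ one_le_sum_of_mem_posHull ?_ σ (h.Δ_eq K hK' ▸ hσ)⟩
    rintro _ ⟨a, ha, rfl⟩
    exact (one_le_sum_expPoint D.d_pos K a).2 (hs a ha)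
  · intro hK
    refine ⟨h.fabric_eq ▸ hK.1, fun a ha => (one_le_sum_expPoint D.d_pos K a).1 ?_⟩
    refine D.one_le_of_mem_Sing hK _ ?_
    rw [h.Δ_eq K hK.1]
    exact subset_posHull _ ⟨a, ha, rfl⟩

theorem lam_expPoint_sub {I : Type u} [DecidableEq I] {d : ℕ} (hd : 0 < d) {J : Finset I}
    {J' : Finset (Option I)} {a : I → ℕ} (ha : d ≤ ∑ j ∈ J, a j) :
    lam J J' (expPoint d _ a) - eInfty J' = expPoint d J' (transformExp d J a) := by
  have hd' : (d : ℝ) ≠ 0 := by exact_mod_cast hd.ne'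
  funext ⟨j, hj⟩
  cases j with
  | none =>
    have := sum_expPoint d J a
    change ∑ j : J, (a j : ℝ) / d - 1 = ((∑ j ∈ J, a j - d : ℕ) : ℝ) / d
    rw [Nat.cast_sub ha, sub_div, div_self hd', ← this]
    rfl
  | some i => exact sub_zero _

theorem IsModel.charTransform {I : Type u} [DecidableEq I] {X : ExponentSystem I}
    {D : PolyhedraSystem I} (h : IsModel X D) {J : Finset I} (hJ : J ∈ D.Sing) :
    IsModel (X.blowUp D.d J) (D.charTransform J hJ) where
  fabric_eq := congrArg (·.blowUp J) h.fabric_eq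
  Δ_eq K' hK' := by
    have hK := (SupportFabric.mem_blowUp.1 hK').1
    have hX : below J K' ∈ X.fabric.strata := h.fabric_eq ▸ hK
    change D.charΔ J K' = posHull (expPoint D.d K' '' (transformExp D.d J '' X.exps (below J K')))
    by_cases hn : none ∈ K'
    · have hs := ExponentSystem.le_sum_of_subset (h.mem_sing_iff.2 hJ) (subset_below hn) hX
      rw [below_of_mem hn] at hs hK ⊢
      rw [PolyhedraSystem.charΔ, PolyhedraSystem.totalΔ, if_pos hn, h.Δ_eq _ hK]
      rw [show posHull (lam J K' '' posHull (expPoint D.d _ '' X.exps (K'.eraseNone ∪ J))) = _ from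
        posHull_image_posHull (lamLin J K') (lamLin_nonneg J K') _, image_sub_posHull,
        Set.image_image, Set.image_image, Set.image_image]
      exact congrArg posHull (Set.image_congr fun a ha => lam_expPoint_sub D.d_pos (hs a ha))
    · rw [below_of_notMem hn] at hK ⊢
      have e0 : eInfty K' = 0 := by
        funext ⟨j, hj⟩
        cases j with
        | none => exact absurd hj hn
        | some i => rfl
      rw [PolyhedraSystem.charΔ, PolyhedraSystem.totalΔ, if_neg hn, e0]
      simp only [sub_zero, Set.image_id']
      apply Function.Injective.image_injective (dropNone_bijective hn).1
      rw [Set.image_preimage_eq _ (dropNone_bijective hn).2, h.Δ_eq _ hK,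
        image_posHull _ dropNone_image_nonneg, Set.image_image, Set.image_image]
      rfl

/-- The model of a polyhedra system given by all the points of its polyhedra with coordinates in
`(1/d) ℤ_{≥0}`. -/
noncomputable def PolyhedraSystem.toExponentSystem {I : Type u} [DecidableEq I]
    (D : PolyhedraSystem I) : ExponentSystem I where
  fabric := D.fabric
  exps K := {a | expPoint D.d K a ∈ D.Δ K}
  nonempty K hK := by
    obtain ⟨A, hA, hΔ⟩ := D.isCharPolyhedron K hK
    have hne := D.nonempty K hK
    rw [hΔ] at hne
    have hAne : A.Nonempty := by
      by_contra hc
      rw [Set.not_nonempty_iff_eq_empty] at hc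
      simp [hc, posHull] at hne
    obtain ⟨σ, hσ⟩ := hAne
    obtain ⟨a, rfl⟩ := exists_expPoint_eq (hA σ hσ)
    refine ⟨a, ?_⟩
    change _ ∈ D.Δ K
    rw [hΔ]
    exact subset_posHull A hσ
  restrict J K h hK a ha := by
    refine ⟨a, ?_, fun _ _ => le_rfl⟩
    change _ ∈ D.Δ J
    rw [D.proj J K h hK]
    exact ⟨_, ha, rfl⟩
  extend J K h hK b hb := by
    have hd : (0 : ℝ) < D.d := by exact_mod_cast D.d_pos
    change _ ∈ D.Δ J at hb
    rw [D.proj J K h hK] at hb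
    obtain ⟨σ, hσ, hσb⟩ := hb
    -- The lift `σ` of `b` need not be a lattice point. Rounding its coordinates outside `J` up to
    -- multiples of `1/d` stays in the polyhedron, which is stable under adding non-negative
    -- vectors.
    let a : I → ℕ := fun i => if i ∈ J then b i else
      if hi : i ∈ K then ⌈σ ⟨i, hi⟩ * D.d⌉₊ else 0
    have hle : ∀ k : K, σ k ≤ expPoint D.d K a k := by
      intro k
      by_cases hk : k.1 ∈ J
      · have : σ k = expPoint D.d J b ⟨k.1, hk⟩ := congrFun hσb ⟨k.1, hk⟩
        simp [this, expPoint, a, hk]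
      · simp only [expPoint, a, hk, k.2, if_false, dif_pos]
        rw [le_div_iff₀ hd]
        exact Nat.le_ceil _
    refine ⟨a, ?_, fun k hk => by simp [a, hk]⟩
    change expPoint D.d K a ∈ D.Δ K
    rw [← D.posHull_Δ hK, ← add_sub_cancel σ (expPoint D.d K a)]
    exact add_mem_posHull (subset_posHull _ hσ) fun k => sub_nonneg.2 (hle k)

theorem PolyhedraSystem.isModel_toExponentSystem {I : Type u} [DecidableEq I]
    (D : PolyhedraSystem I) : IsModel D.toExponentSystem D where
  fabric_eq := rfl
  Δ_eq K hK := by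
    refine Set.Subset.antisymm ?_ ?_
    · obtain ⟨A, hA, hΔ⟩ := D.isCharPolyhedron K hK
      conv_lhs => rw [hΔ]
      refine posHull_mono fun σ hσ => ?_
      obtain ⟨a, rfl⟩ := exists_expPoint_eq (hA σ hσ)
      refine ⟨a, ?_, rfl⟩
      change _ ∈ D.Δ K
      rw [hΔ]
      exact subset_posHull A hσ
    · conv_rhs => rw [← D.posHull_Δ hK]
      refine posHull_mono ?_
      rintro _ ⟨a, ha, rfl⟩
      exact ha

/-- `Resolvable` peels off the first transform while `FiniteCharSeq` appends the last, so the
sequence already built from `D₀` is carried along as an accumulator. -/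
theorem Resolvable.exists_finiteCharSeq {I₀ : Type u} [DecidableEq I₀] {D₀ : PolyhedraSystem I₀}
    {m : ℕ} {I : Type u} [DecidableEq I] {X : ExponentSystem I} (hX : Resolvable m X) :
    ∀ {D : PolyhedraSystem I}, D.d = m → IsModel X D → FiniteCharSeq D₀ D →
      ∃ (I' : Type u) (_ : DecidableEq I') (D' : PolyhedraSystem I'),
        FiniteCharSeq D₀ D' ∧ D'.Sing = ∅ := by
  induction hX with
  | of_sing_eq_empty X h =>
    rintro D rfl hD hseq
    exact ⟨_, _, D, hseq, by rw [← h]; ext K; exact hD.mem_sing_iff.symm⟩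
  | of_blowUp X J hJ _ ih =>
    rintro D rfl hD hseq
    have hJ' := hD.mem_sing_iff.1 hJ
    exact ih (D := D.charTransform J hJ') rfl (hD.charTransform hJ') (.step hseq J hJ')

end PolyhedraSystems

theorem mainTheorem1 {I : Type u} [Finite I] [DecidableEq I]
    (D : PolyhedraSystems.PolyhedraSystem I) :
    ∃ (I' : Type u) (_ : DecidableEq I') (D' : PolyhedraSystems.PolyhedraSystem I'),
      PolyhedraSystems.FiniteCharSeq D D' ∧ D'.Sing = ∅ :=
  (D.toExponentSystem.resolvable D.d_pos).exists_finiteCharSeq rfl D.isModel_toExponentSystem .refl
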